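/- Let $p\colon\mathbb N\to[1,\infty]$, $\mathbb N=\{1,2,\dots\}$. For $t,s\ge 0$ put $t\boxplus_r s=(t^r+s^r)^{1/r}$ if $1\le r<\infty$ and $t\boxplus_\infty s=\max(t,s)$. For a bounded real sequence $x=(x_n)$ let $|||x|||_{(0)}=|x_1|$ and $|||x|||_{(k)}=|||x|||_{(k-1)}\boxplus_{p(k)}|x_{k+1}|$ for $k\ge 1$. Let $\ell^{p(\cdot)}$ be the space of all bounded real sequences $x$ with $\|x\|:=\lim_{k\to\infty}|||x|||_{(k)}<\infty$, with this norm and the coordinatewise order. Then the following conditions are equivalent: 1. $\ell^{p(\cdot)}$ is reflexive. 2. $\ell^{p(\cdot)}$ is superreflexive (every Banach space that is finitely representable in it is reflexive). 3. $\liminf_{n\to\infty}p(n)>1$ and $\limsup_{n\to\infty}p(n)<\infty$. 4. $\ell^{p(\cdot)}$ is an Asplund space (every separable subspace has a separable dual). Moreover, if condition 3 holds, there are $p_0\in(1,\liminf_n p(n)]$, $q_0\in[\limsup_n p(n),\infty)$ with $p_0\le q_0$, and a constant $C$, such that $\ell^{p(\cdot)}$ satisfies an upper $p_0$-estimate and a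 lower $q_0$-estimate with constant $C$: $$\Big\|\sum_{i=1}^m x_i\Big\|\le C\Big(\sum_{i=1}^m\|x_i\|^{p_0}\Big)^{1/p_0},\qquad \Big(\sum_{i=1}^m\|x_i\|^{q_0}\Big)^{1/q_0}\le C\Big\|\sum_{i=1}^m x_i\Big\|$$ for all finite families of pairwise disjoint vectors $x_1,\dots,x_m\in\ell^{p(\cdot)}$ (that is, $|x_i|\wedge|x_j|=0$ for $i\ne j$). If $1<p_0\le q_0<\infty$ and $p_0\le p(n)\le q_0$ for every $n$, then both estimates hold for $p_0$ and $q_0$ with $C=1$. -/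

import Mathlib

open Filter Topology
open scoped ENNReal

noncomputable section

/-! ### Classes of normed spaces -/

/-- A real normed space is reflexive if the canonical map into its bidual is onto. -/
def IsReflexiveSpace (X : Type*) [NormedAddCommGroup X] [NormedSpace ℝ X] : Prop :=
  Function.Surjective (NormedSpace.inclusionInDoubleDual ℝ X)

/-- `Y` is finitely representable in `X`: for every `ε > 0`, every finite-dimensional subspace `F`
of `Y` is `(1 + ε)`-isomorphic to a subspace `E` of `X`. -/
def FinitelyRepresentable (Y X : Type*) [NormedAddCommGroup Y] [NormedSpace ℝ Y]
    [NormedAddCommGroup X] [NormedSpace ℝ X] : Prop :=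
  ∀ ε : ℝ, 0 < ε → ∀ F : Submodule ℝ Y, FiniteDimensional ℝ F →
    ∃ (E : Submodule ℝ X) (T : F ≃L[ℝ] E),
      ‖(T : F →L[ℝ] E)‖ * ‖(T.symm : E →L[ℝ] F)‖ ≤ 1 + ε

/-- `X` is superreflexive if every Banach space finitely representable in `X` is reflexive.
(Testing Banach spaces in the universe of `X` is enough, as a nonreflexive space has a separable
nonreflexive closed subspace.) -/
def IsSuperreflexiveSpace.{u} (X : Type u) [NormedAddCommGroup X] [NormedSpace ℝ X] : Prop :=
  ∀ (Y : Type u) [NormedAddCommGroup Y] [NormedSpace ℝ Y] [CompleteSpace Y],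
    FinitelyRepresentable Y X → IsReflexiveSpace Y

/-- `X` is an Asplund space if every separable subspace of `X` has a (norm) separable dual. -/
def IsAsplundSpace (X : Type*) [NormedAddCommGroup X] [NormedSpace ℝ X] : Prop :=
  ∀ Y : Submodule ℝ X, TopologicalSpace.SeparableSpace Y →
    TopologicalSpace.SeparableSpace (StrongDual ℝ Y)

/-! ### Estimates in normed lattices -/

/-- Upper `p`-estimate with constant `C`, over finite families of pairwise disjoint vectors. -/
def HasUpperEstimate (X : Type*) [NormedAddCommGroup X] [Lattice X] (p C : ℝ) : Prop :=
  ∀ (n : ℕ) (x : Fin n → X), (∀ i j, i ≠ j → |x i| ⊓ |x j| = 0) →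
    ‖∑ i, x i‖ ≤ C * (∑ i, ‖x i‖ ^ p) ^ (1 / p)

/-- Lower `q`-estimate with constant `C`, over finite families of pairwise disjoint vectors. -/
def HasLowerEstimate (X : Type*) [NormedAddCommGroup X] [Lattice X] (q C : ℝ) : Prop :=
  ∀ (n : ℕ) (x : Fin n → X), (∀ i j, i ≠ j → |x i| ⊓ |x j| = 0) →
    (∑ i, ‖x i‖ ^ q) ^ (1 / q) ≤ C * ‖∑ i, x i‖

/-! ### The variable exponent space -/

/-- `t ⊞_p s = (t ^ p + s ^ p) ^ (1 / p)` for `p < ∞`, and `t ⊞_∞ s = max t s`. -/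
def boxPlus (p : ℝ≥0∞) (t s : ℝ) : ℝ :=
  if p = ∞ then max t s else (t ^ p.toReal + s ^ p.toReal) ^ (1 / p.toReal)

/-- The seminorms `|x₀|`, `|x₀| ⊞_{p 0} |x₁|`, `(|x₀| ⊞_{p 0} |x₁|) ⊞_{p 1} |x₂|`, …
The coordinates and the exponents are both numbered from `0`, so that `p k` is the exponent that
adjoins the coordinate `k + 1`. -/
def partialNorm (p : ℕ → Set.Icc (1 : ℝ≥0∞) ∞) (x : ℕ → ℝ) : ℕ → ℝ
  | 0 => |x 0|
  | k + 1 => boxPlus (p k) (partialNorm p x k) |x (k + 1)|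

theorem boxPlus_nonneg (p : ℝ≥0∞) {t s : ℝ} (ht : 0 ≤ t) (hs : 0 ≤ s) : 0 ≤ boxPlus p t s := by
  unfold boxPlus
  split_ifs
  · exact le_max_of_le_left ht
  · positivity

theorem toReal_one_le {p : ℝ≥0∞} (hp : 1 ≤ p) (h : p ≠ ∞) : 1 ≤ p.toReal := by
  simpa using ENNReal.toReal_mono h hp

theorem boxPlus_mono (p : ℝ≥0∞) {t s t' s' : ℝ} (ht : 0 ≤ t) (hs : 0 ≤ s)
    (h : t ≤ t') (h' : s ≤ s') : boxPlus p t s ≤ boxPlus p t' s' := by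
  unfold boxPlus
  split_ifs
  · exact max_le_max h h'
  · gcongr

theorem boxPlus_add_le {p : ℝ≥0∞} (hp : 1 ≤ p) {t s t' s' : ℝ} (ht : 0 ≤ t) (hs : 0 ≤ s)
    (ht' : 0 ≤ t') (hs' : 0 ≤ s') :
    boxPlus p (t + t') (s + s') ≤ boxPlus p t s + boxPlus p t' s' := by
  unfold boxPlus
  split_ifs with h
  · exact max_add_add_le_max_add_max
  · have := Real.Lp_add_le_of_nonneg (Finset.univ : Finset (Fin 2)) (f := ![t, s]) (g := ![t', s'])
      (toReal_one_le hp h) (by simp [Fin.forall_fin_two, ht, hs])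
      (by simp [Fin.forall_fin_two, ht', hs'])
    simpa [Fin.sum_univ_two] using this

theorem boxPlus_mul {p : ℝ≥0∞} (hp : 1 ≤ p) {c t s : ℝ} (hc : 0 ≤ c) (ht : 0 ≤ t) (hs : 0 ≤ s) :
    boxPlus p (c * t) (c * s) = c * boxPlus p t s := by
  unfold boxPlus
  split_ifs with h
  · exact (mul_max_of_nonneg _ _ hc).symm
  · have h1 := toReal_one_le hp h
    rw [Real.mul_rpow hc ht, Real.mul_rpow hc hs, ← mul_add,
      Real.mul_rpow (by positivity) (by positivity), ← Real.rpow_mul hc,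
      mul_one_div_cancel (by linarith), Real.rpow_one]

theorem left_le_boxPlus {p : ℝ≥0∞} (hp : 1 ≤ p) {t s : ℝ} (ht : 0 ≤ t) (hs : 0 ≤ s) :
    t ≤ boxPlus p t s := by
  unfold boxPlus
  split_ifs with h
  · exact le_max_left _ _
  · have h1 := toReal_one_le hp h
    calc t = (t ^ p.toReal) ^ (1 / p.toReal) := by
          rw [← Real.rpow_mul ht, mul_one_div_cancel (by linarith), Real.rpow_one]
      _ ≤ _ := by
          have := Real.rpow_nonneg hs p.toReal
          gcongr
          linarith

theorem boxPlus_comm (p : ℝ≥0∞) (t s : ℝ) : boxPlus p t s = boxPlus p s t := by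
  unfold boxPlus
  rw [max_comm, add_comm]

theorem right_le_boxPlus {p : ℝ≥0∞} (hp : 1 ≤ p) {t s : ℝ} (ht : 0 ≤ t) (hs : 0 ≤ s) :
    s ≤ boxPlus p t s := by
  rw [boxPlus_comm]
  exact left_le_boxPlus hp hs ht

section PartialNorm

variable (p : ℕ → Set.Icc (1 : ℝ≥0∞) ∞)

theorem partialNorm_nonneg (x : ℕ → ℝ) (k : ℕ) : 0 ≤ partialNorm p x k := by
  induction k with
  | zero => exact abs_nonneg _
  | succ k ih => exact boxPlus_nonneg _ ih (abs_nonneg _)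

theorem partialNorm_monotone (x : ℕ → ℝ) : Monotone (partialNorm p x) :=
  monotone_nat_of_le_succ fun k =>
    left_le_boxPlus (p k).2.1 (partialNorm_nonneg p x k) (abs_nonneg _)

theorem abs_le_partialNorm (x : ℕ → ℝ) (k : ℕ) : |x k| ≤ partialNorm p x k := by
  cases k with
  | zero => exact le_rfl
  | succ k => exact right_le_boxPlus (p k).2.1 (partialNorm_nonneg p x k) (abs_nonneg _)

theorem partialNorm_mono {x y : ℕ → ℝ} (h : ∀ n, |x n| ≤ |y n|) (k : ℕ) :
    partialNorm p x k ≤ partialNorm p y k := by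
  induction k with
  | zero => exact h 0
  | succ k ih => exact boxPlus_mono _ (partialNorm_nonneg p x k) (abs_nonneg _) ih (h _)

theorem partialNorm_add_le (x y : ℕ → ℝ) (k : ℕ) :
    partialNorm p (x + y) k ≤ partialNorm p x k + partialNorm p y k := by
  induction k with
  | zero => exact abs_add_le _ _
  | succ k ih =>
    exact (boxPlus_mono _ (partialNorm_nonneg p _ k) (abs_nonneg _) ih (abs_add_le _ _)).trans
      (boxPlus_add_le (p k).2.1 (partialNorm_nonneg p x k) (abs_nonneg _)
        (partialNorm_nonneg p y k) (abs_nonneg _))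

theorem partialNorm_smul (c : ℝ) (x : ℕ → ℝ) (k : ℕ) :
    partialNorm p (c • x) k = |c| * partialNorm p x k := by
  induction k with
  | zero => exact abs_mul _ _
  | succ k ih =>
    simp only [partialNorm, ih, Pi.smul_apply, smul_eq_mul, abs_mul]
    exact boxPlus_mul (p k).2.1 (abs_nonneg _) (partialNorm_nonneg p x k) (abs_nonneg _)

/-- The bounded real sequences for which `lim_k |||x|||_k` is finite, as a linear subspace of the
space of all sequences. The sequence `|||x|||_k` is nondecreasing, so its limit is finite exactly if
it is bounded. -/
def varLpSubmodule : Submodule ℝ (ℕ → ℝ) where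
  carrier := {x | BddAbove (Set.range fun n => |x n|) ∧ BddAbove (Set.range (partialNorm p x))}
  zero_mem' := by
    have h : ∀ k, partialNorm p 0 k ≤ 0 := fun k => by
      have := partialNorm_smul p 0 0 k
      simp at this
      exact this.le
    exact ⟨⟨0, by rintro _ ⟨n, rfl⟩; simp⟩, ⟨0, by rintro _ ⟨n, rfl⟩; exact h n⟩⟩
  add_mem' := by
    rintro x y ⟨⟨a, ha⟩, ⟨b, hb⟩⟩ ⟨⟨c, hc⟩, ⟨d, hd⟩⟩
    refine ⟨⟨a + c, ?_⟩, ⟨b + d, ?_⟩⟩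
    · rintro _ ⟨n, rfl⟩
      exact (abs_add_le _ _).trans (add_le_add (ha ⟨n, rfl⟩) (hc ⟨n, rfl⟩))
    · rintro _ ⟨n, rfl⟩
      exact (partialNorm_add_le p x y n).trans (add_le_add (hb ⟨n, rfl⟩) (hd ⟨n, rfl⟩))
  smul_mem' := by
    rintro r x ⟨⟨a, ha⟩, ⟨b, hb⟩⟩
    refine ⟨⟨|r| * a, ?_⟩, ⟨|r| * b, ?_⟩⟩
    · rintro _ ⟨n, rfl⟩
      simp only [Pi.smul_apply, smul_eq_mul, abs_mul]
      exact mul_le_mul_of_nonneg_left (ha ⟨n, rfl⟩) (abs_nonneg r)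
    · rintro _ ⟨n, rfl⟩
      rw [partialNorm_smul]
      exact mul_le_mul_of_nonneg_left (hb ⟨n, rfl⟩) (abs_nonneg r)

theorem varLpSubmodule_solid {x y : ℕ → ℝ} (h : ∀ n, |x n| ≤ |y n|) (hy : y ∈ varLpSubmodule p) :
    x ∈ varLpSubmodule p := by
  obtain ⟨⟨a, ha⟩, ⟨b, hb⟩⟩ := hy
  refine ⟨⟨a, ?_⟩, ⟨b, ?_⟩⟩
  · rintro _ ⟨n, rfl⟩
    exact (h n).trans (ha ⟨n, rfl⟩)
  · rintro _ ⟨n, rfl⟩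
    exact (partialNorm_mono p h n).trans (hb ⟨n, rfl⟩)

theorem varLpSubmodule_abs {x : ℕ → ℝ} (hx : x ∈ varLpSubmodule p) : |x| ∈ varLpSubmodule p :=
  varLpSubmodule_solid p (fun n => by simp) hx

theorem varLpSubmodule_sup {x y : ℕ → ℝ} (hx : x ∈ varLpSubmodule p)
    (hy : y ∈ varLpSubmodule p) : x ⊔ y ∈ varLpSubmodule p := by
  refine varLpSubmodule_solid p (fun n => ?_)
    (add_mem (varLpSubmodule_abs p hx) (varLpSubmodule_abs p hy))
  simp only [Pi.sup_apply, Pi.add_apply, Pi.abs_apply]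
  rw [abs_of_nonneg (add_nonneg (abs_nonneg (x n)) (abs_nonneg (y n)))]
  have h1 := abs_nonneg (x n)
  have h2 := abs_nonneg (y n)
  rcases max_cases (x n) (y n) with h | h <;> rw [h.1] <;> linarith

theorem varLpSubmodule_inf {x y : ℕ → ℝ} (hx : x ∈ varLpSubmodule p)
    (hy : y ∈ varLpSubmodule p) : x ⊓ y ∈ varLpSubmodule p := by
  refine varLpSubmodule_solid p (fun n => ?_)
    (add_mem (varLpSubmodule_abs p hx) (varLpSubmodule_abs p hy))
  simp only [Pi.inf_apply, Pi.add_apply, Pi.abs_apply]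
  rw [abs_of_nonneg (add_nonneg (abs_nonneg (x n)) (abs_nonneg (y n)))]
  have h1 := abs_nonneg (x n)
  have h2 := abs_nonneg (y n)
  rcases min_cases (x n) (y n) with h | h <;> rw [h.1] <;> linarith

/-- The variable exponent space `ℓ^{p(·)}`. It is a type of its own, so that it does not inherit the
product topology. -/
def VarLp : Type := varLpSubmodule p

end PartialNorm

namespace VarLp

variable {p : ℕ → Set.Icc (1 : ℝ≥0∞) ∞}

instance : AddCommGroup (VarLp p) := inferInstanceAs (AddCommGroup (varLpSubmodule p))

instance : Module ℝ (VarLp p) := inferInstanceAs (Module ℝ (varLpSubmodule p))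

/-- The sequence underlying an element of the space. -/
def seq (x : VarLp p) : ℕ → ℝ := Subtype.val x

theorem seq_mem (x : VarLp p) : x.seq ∈ varLpSubmodule p := Subtype.property x

theorem seq_injective : Function.Injective (seq (p := p)) := Subtype.val_injective

theorem seq_zero : (0 : VarLp p).seq = 0 := rfl

theorem seq_add (x y : VarLp p) : (x + y).seq = x.seq + y.seq := rfl

theorem seq_neg (x : VarLp p) : (-x).seq = -x.seq := rfl

theorem seq_smul (c : ℝ) (x : VarLp p) : (c • x).seq = c • x.seq := rfl

/-- `‖x‖ = lim_k |||x|||_k = sup_k |||x|||_k`. -/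
instance : Norm (VarLp p) := ⟨fun x => ⨆ k, partialNorm p x.seq k⟩

theorem norm_def (x : VarLp p) : ‖x‖ = ⨆ k, partialNorm p x.seq k := rfl

theorem tendsto_partialNorm (x : VarLp p) :
    Tendsto (partialNorm p x.seq) atTop (𝓝 ‖x‖) :=
  tendsto_atTop_ciSup (partialNorm_monotone p x.seq) x.seq_mem.2

theorem partialNorm_le_norm (x : VarLp p) (k : ℕ) : partialNorm p x.seq k ≤ ‖x‖ :=
  le_ciSup x.seq_mem.2 k

theorem normedSpaceCore : NormedSpace.Core ℝ (VarLp p) where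
  norm_nonneg x := (partialNorm_nonneg p x.seq 0).trans (x.partialNorm_le_norm 0)
  norm_smul c x := by
    rw [norm_def, norm_def, seq_smul, Real.norm_eq_abs, Real.mul_iSup_of_nonneg (abs_nonneg c)]
    simp only [partialNorm_smul]
  norm_triangle x y := ciSup_le fun k => by
    rw [seq_add]
    exact (partialNorm_add_le p _ _ k).trans
      (add_le_add (x.partialNorm_le_norm k) (y.partialNorm_le_norm k))
  norm_eq_zero_iff x := by
    refine ⟨fun h => seq_injective (funext fun n => ?_), ?_⟩
    · have := (abs_le_partialNorm p x.seq n).trans (x.partialNorm_le_norm n)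
      rw [h] at this
      exact abs_nonpos_iff.1 this
    · rintro rfl
      have h : ∀ k, partialNorm p (0 : ℕ → ℝ) k = 0 := fun k => by
        simpa using partialNorm_smul p 0 0 k
      rw [norm_def, seq_zero]
      simp [h]

instance : NormedAddCommGroup (VarLp p) := NormedAddCommGroup.ofCore normedSpaceCore

instance : NormedSpace ℝ (VarLp p) := NormedSpace.ofCore normedSpaceCore

/-- The coordinatewise order. -/
instance : Lattice (VarLp p) where
  __ := PartialOrder.lift (seq (p := p)) seq_injective
  sup x y := ⟨x.seq ⊔ y.seq, varLpSubmodule_sup p x.seq_mem y.seq_mem⟩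
  inf x y := ⟨x.seq ⊓ y.seq, varLpSubmodule_inf p x.seq_mem y.seq_mem⟩
  le_sup_left x y := (le_sup_left : x.seq ≤ x.seq ⊔ y.seq)
  le_sup_right x y := (le_sup_right : y.seq ≤ x.seq ⊔ y.seq)
  sup_le x y z hx hy := (sup_le hx hy : x.seq ⊔ y.seq ≤ z.seq)
  inf_le_left x y := (inf_le_left : x.seq ⊓ y.seq ≤ x.seq)
  inf_le_right x y := (inf_le_right : x.seq ⊓ y.seq ≤ y.seq)
  le_inf x y z hx hy := (le_inf hx hy : x.seq ≤ y.seq ⊓ z.seq)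

theorem seq_abs (x : VarLp p) : (|x|).seq = |x.seq| := rfl

instance : IsOrderedAddMonoid (VarLp p) where
  add_le_add_left x y h z := by
    have h' : x.seq ≤ y.seq := h
    have : x.seq + z.seq ≤ y.seq + z.seq := by gcongr
    exact this

instance : HasSolidNorm (VarLp p) where
  solid x y h := by
    have h' : |x.seq| ≤ |y.seq| := h
    exact ciSup_le fun k => (partialNorm_mono p (fun n => h' n) k).trans (y.partialNorm_le_norm k)

end VarLp

end

/-! The cycle is 3 → 2 → 1 → 4 → 3.

For 3 → 2, changing finitely many exponents gives an equivalent norm, so all exponents may be taken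
in `[P, Q]` with `1 < P ≤ 2 ≤ Q < ∞`. For scalars there is a two-point inequality between the `Q`-th
powers of `(s + t) / 2` and `(s - t) / 2` and the `P`-mean of `|s|`, `|t|` (`two_point_inequality`).
It has the form "`ℓ^Q`-sum ≤ `ℓ^P`-sum", and Minkowski's inequality for mixed norms carries every
such inequality through each `⊞_r` with `P ≤ r ≤ Q` (`lpAdd_partialNorm_le`). Hence the norm
satisfies it too. An ultrafilter limit transfers it to every finitely representable space, up to
equivalence, and there a Milman–Pettis argument gives reflexivity. Fed with disjoint sequences, the
same transfer principle yields the upper and lower estimates.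

2 → 1 holds because a space is finitely representable in itself. In 1 → 4, reflexivity makes the
span of the coordinate functionals dense in the dual.

For 4 → 3, if exponents come close to 1 (or become arbitrarily large), a sparse subsequence of
coordinates does so fast enough that the accumulated distortion from `ℓ¹` (or `ℓ^∞`) is at most 2.
Both cases produce an `ℓ¹`-sequence, whose span has a nonseparable dual. -/

section Abstract

/-! ### Reflexivity, finite representability and Asplund spaces. -/

variable {X Y : Type*} [NormedAddCommGroup X] [NormedSpace ℝ X]
  [NormedAddCommGroup Y] [NormedSpace ℝ Y]

/-- A form of Goldstine's theorem. -/
theorem exists_norm_le_forall_abs_sub_lt (φ : StrongDual ℝ (StrongDual ℝ Y))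
    (G : Finset (StrongDual ℝ Y)) {ε : ℝ} (hε : 0 < ε) :
    ∃ y : Y, ‖y‖ ≤ ‖φ‖ + 1 ∧ ∀ f ∈ G, |f y - φ f| < ε := by
  classical
  have hR : 0 < ‖φ‖ + 1 := by positivity
  let A : Y →ₗ[ℝ] (G → ℝ) := LinearMap.pi fun f => (f.1 : Y →ₗ[ℝ] ℝ)
  let v : G → ℝ := fun f => φ f.1
  by_cases hv : v ∈ closure (A '' Metric.closedBall 0 (‖φ‖ + 1))
  · obtain ⟨_, ⟨y, hy, rfl⟩, hd⟩ := Metric.mem_closure_iff.1 hv ε hε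
    refine ⟨y, by simpa using hy, fun f hf => ?_⟩
    have := (dist_pi_lt_iff hε).1 hd ⟨f, hf⟩
    rwa [dist_comm, Real.dist_eq] at this
  -- A functional `l` separating `v` from the image of the ball pulls back to `g` in the span of
  -- `G`. Then `‖g‖ ≤ u / (‖φ‖ + 1)`, although `φ g = l v > u`.
  · exfalso
    obtain ⟨l, u, hl, hu⟩ := geometric_hahn_banach_closed_point
      (((convex_closedBall (0 : Y) (‖φ‖ + 1)).linear_image A).closure) isClosed_closure hv
    let g : StrongDual ℝ Y := ∑ f : G, l (Pi.single f 1) • f.1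
    have hlw : ∀ w : G → ℝ, l w = ∑ f, w f * l (Pi.single f 1) := fun w => by
      have := LinearMap.pi_apply_eq_sum_univ (l : (G → ℝ) →ₗ[ℝ] ℝ) w
      simp only [ContinuousLinearMap.coe_coe, smul_eq_mul] at this
      rw [this]
      refine Finset.sum_congr rfl fun i _ => ?_
      congr 2
      ext j
      simp [Pi.single_apply, eq_comm]
    have hg : ∀ y, g y = l (A y) := fun y => by
      rw [hlw]
      simp [g, A, mul_comm]
    have hφ : φ g = l v := by
      rw [hlw]
      simp [g, v, mul_comm]
    have hb : ∀ y, ‖y‖ ≤ ‖φ‖ + 1 → g y < u := fun y hy => by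
      rw [hg]
      exact hl _ (subset_closure ⟨y, by simpa using hy, rfl⟩)
    have hu0 : 0 < u := by simpa using hb 0 (by simpa using hR.le)
    have hle : ∀ y, g y ≤ u / (‖φ‖ + 1) * ‖y‖ := fun y => by
      rcases eq_or_ne y 0 with rfl | hy
      · simp
      have hy' : 0 < ‖y‖ := norm_pos_iff.2 hy
      have := hb (((‖φ‖ + 1) / ‖y‖) • y) (by
        rw [norm_smul, Real.norm_of_nonneg (by positivity), div_mul_cancel₀ _ hy'.ne'])
      rw [map_smul, smul_eq_mul, div_mul_eq_mul_div, div_lt_iff₀ hy'] at this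
      rw [div_mul_eq_mul_div, le_div_iff₀ hR]
      linarith
    have hgn : ‖g‖ ≤ u / (‖φ‖ + 1) := by
      refine ContinuousLinearMap.opNorm_le_bound _ (by positivity) fun y => ?_
      rw [Real.norm_eq_abs, abs_le']
      refine ⟨hle y, ?_⟩
      have := hle (-y)
      rwa [map_neg, norm_neg] at this
    have h1 : u < ‖φ‖ * (u / (‖φ‖ + 1)) :=
      calc u < φ g := hφ ▸ hu
        _ ≤ ‖φ g‖ := le_abs_self _
        _ ≤ ‖φ‖ * ‖g‖ := φ.le_opNorm g
        _ ≤ _ := by gcongr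
    rw [mul_div_assoc', lt_div_iff₀ hR] at h1
    nlinarith

/-- The Milman–Pettis theorem for a function that is equivalent to the norm. -/
theorem isReflexiveSpace_of_two_point_inequality [CompleteSpace Y] (N : Y → ℝ) {a b c P Q : ℝ}
    (ha : 0 < a) (hc : 0 < c) (hP : 0 < P) (hQ : 0 < Q)
    (hlow : ∀ y, a * ‖y‖ ≤ N y) (hup : ∀ y, N y ≤ b * ‖y‖)
    (hN : ∀ x y, N ((1 / 2 : ℝ) • (x + y)) ^ Q + c * N ((1 / 2 : ℝ) • (x - y)) ^ Q ≤
      ((N x ^ P + N y ^ P) / 2) ^ (Q / P)) :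
    IsReflexiveSpace Y := by
  classical
  intro φ
  have hN0 : ∀ y, 0 ≤ N y := fun y => (by positivity : 0 ≤ a * ‖y‖).trans (hlow y)
  -- The traces on `Y` of weak-* neighbourhoods of `φ`, a directed family of convex sets. The number
  -- `r` below is the asymptotic infimum of `N` along it.
  let W : Finset (StrongDual ℝ Y) × ℕ → Set Y :=
    fun i => {y | ∀ f ∈ i.1, |f y - φ f| ≤ 1 / ((i.2 : ℝ) + 1)}
  have hWanti : ∀ i j, i ≤ j → W j ⊆ W i := fun i j hij y hy f hf =>
    (hy f (hij.1 hf)).trans (Nat.one_div_le_one_div hij.2)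
  let S : Set ℝ := {ρ | ∀ i, ∃ y ∈ W i, N y ≤ ρ}
  have hSne : S.Nonempty := by
    refine ⟨max b 0 * (‖φ‖ + 1), fun i => ?_⟩
    obtain ⟨y, hy, hy'⟩ := exists_norm_le_forall_abs_sub_lt φ i.1
      (Nat.one_div_pos_of_nat (n := i.2) (α := ℝ))
    refine ⟨y, fun f hf => (hy' f hf).le, (hup y).trans ?_⟩
    gcongr
    exact le_max_left _ _
  have hSbdd : BddBelow S := ⟨0, fun ρ hρ => by
    obtain ⟨y, -, hy⟩ := hρ (∅, 0)
    exact (hN0 y).trans hy⟩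
  set r := sInf S with hr
  have hr0 : 0 ≤ r := le_csInf hSne fun ρ hρ => by
    obtain ⟨y, -, hy⟩ := hρ (∅, 0)
    exact (hN0 y).trans hy
  have hadd : ∀ δ, 0 < δ → ∀ i, ∃ y ∈ W i, N y ≤ r + δ := fun δ hδ i => by
    obtain ⟨ρ, hρ, hlt⟩ := exists_lt_of_csInf_lt hSne (show sInf S < r + δ by linarith)
    obtain ⟨y, hy, hy'⟩ := hρ i
    exact ⟨y, hy, hy'.trans hlt.le⟩
  have hsub : ∀ δ, 0 < δ → ∃ i, ∀ y ∈ W i, r - δ < N y := fun δ hδ => by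
    have : r - δ ∉ S := fun h => by linarith [csInf_le hSbdd h]
    simpa [S] using this
  -- Near-minimal points of a small `W i` are close to each other: their midpoint is again in `W i`,
  -- so `N` exceeds `r - δ` there, and the two-point inequality leaves little room for the half
  -- difference.
  have hdiam : ∀ η, 0 < η → ∃ δ, 0 < δ ∧ ∃ i, ∀ y ∈ W i, ∀ z ∈ W i, N y ≤ r + δ → N z ≤ r + δ →
      dist y z < η := fun η hη => by
    have hcont : Tendsto (fun δ : ℝ => (r + δ) ^ Q - (max (r - δ) 0) ^ Q) (𝓝[>] 0) (𝓝 0) := by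
      have h1 : Continuous fun δ : ℝ => (r + δ) ^ Q - (max (r - δ) 0) ^ Q :=
        ((continuous_const.add continuous_id).rpow_const fun _ => Or.inr hQ.le).sub
          (((continuous_const.sub continuous_id).max continuous_const).rpow_const
            fun _ => Or.inr hQ.le)
      have h2 := h1.tendsto 0
      simp only [add_zero, sub_zero, max_eq_left hr0, sub_self] at h2
      exact h2.mono_left nhdsWithin_le_nhds
    have hpos : 0 < c * (a * (η / 2)) ^ Q := by positivity
    obtain ⟨δ, hδ1, hδ⟩ := ((hcont.eventually_lt_const hpos).and self_mem_nhdsWithin).exists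
    have hδ : 0 < δ := hδ
    obtain ⟨i, hi⟩ := hsub δ hδ
    refine ⟨δ, hδ, i, fun y hy z hz hyr hzr => ?_⟩
    have hmid : (1 / 2 : ℝ) • (y + z) ∈ W i := fun f hf => by
      have h1 := abs_le.1 (hy f hf)
      have h2 := abs_le.1 (hz f hf)
      rw [map_smul, map_add, smul_eq_mul, abs_le]
      constructor <;> linarith [h1.1, h1.2, h2.1, h2.2]
    have h1 : (max (r - δ) 0) ^ Q ≤ N ((1 / 2 : ℝ) • (y + z)) ^ Q :=
      Real.rpow_le_rpow (le_max_right _ _) (max_le (hi _ hmid).le (hN0 _)) hQ.le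
    have h2 : ((N y ^ P + N z ^ P) / 2) ^ (Q / P) ≤ (r + δ) ^ Q := by
      have h3 := Real.rpow_le_rpow (hN0 y) hyr hP.le
      have h4 := Real.rpow_le_rpow (hN0 z) hzr hP.le
      have h5 := Real.rpow_nonneg (hN0 y) P
      have h6 := Real.rpow_nonneg (hN0 z) P
      calc ((N y ^ P + N z ^ P) / 2) ^ (Q / P) ≤ ((r + δ) ^ P) ^ (Q / P) :=
            Real.rpow_le_rpow (by linarith) (by linarith) (by positivity)
        _ = (r + δ) ^ Q := by
            rw [← Real.rpow_mul (by linarith), mul_div_cancel₀ _ hP.ne']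
    have h3 := hN y z
    have h4 : c * N ((1 / 2 : ℝ) • (y - z)) ^ Q < c * (a * (η / 2)) ^ Q := by linarith
    have h5 := lt_of_mul_lt_mul_left h4 hc.le
    have h6 := (Real.rpow_lt_rpow_iff (hN0 _) (by positivity) hQ).1 h5
    have h7 := lt_of_mul_lt_mul_left ((hlow _).trans_lt h6) ha.le
    rw [norm_smul, Real.norm_of_nonneg (by norm_num)] at h7
    rw [dist_eq_norm]
    linarith
  choose u hu hur using fun i : Finset (StrongDual ℝ Y) × ℕ =>
    hadd (1 / ((i.2 : ℝ) + 1)) Nat.one_div_pos_of_nat i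
  have hcau : CauchySeq u := by
    refine Metric.cauchySeq_iff'.2 fun η hη => ?_
    obtain ⟨δ, hδ, i, hi⟩ := hdiam η hη
    obtain ⟨n, hn⟩ := exists_nat_one_div_lt hδ
    have key : ∀ j, (i.1, max i.2 n) ≤ j → u j ∈ W i ∧ N (u j) ≤ r + δ := fun j hj =>
      ⟨hWanti i j ⟨hj.1, (le_max_left _ _).trans hj.2⟩ (hu j), (hur j).trans (by
        have := Nat.one_div_le_one_div (α := ℝ) ((le_max_right _ _).trans hj.2)
        linarith)⟩
    exact ⟨(i.1, max i.2 n), fun j hj =>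
      hi _ (key j hj).1 _ (key _ le_rfl).1 (key j hj).2 (key _ le_rfl).2⟩
  obtain ⟨y, hy⟩ := cauchySeq_tendsto_of_complete hcau
  refine ⟨y, ContinuousLinearMap.ext fun f => ?_⟩
  have h1 : Tendsto (fun i => f (u i)) atTop (𝓝 (f y)) := (f.continuous.tendsto y).comp hy
  have h2 : Tendsto (fun i => f (u i)) atTop (𝓝 (φ f)) := by
    refine Metric.tendsto_atTop.2 fun ε hε => ?_
    obtain ⟨n, hn⟩ := exists_nat_one_div_lt hε
    refine ⟨({f}, n), fun j hj => ?_⟩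
    rw [Real.dist_eq]
    exact (hWanti _ _ hj (hu j) f (by simp)).trans_lt hn
  exact tendsto_nhds_unique h1 h2

/-- Pull `M` back along 2-isomorphic embeddings of the spans of finite sets and take a limit along
an ultrafilter of finite sets. The limit inherits the two-point inequality and is equivalent to the
norm of `Y`; it need not be a norm. -/
theorem isReflexiveSpace_of_finitelyRepresentable [CompleteSpace Y] (M : X → ℝ) {a b c P Q : ℝ}
    (ha : 0 < a) (hb : 0 ≤ b) (hc : 0 < c) (hP : 0 < P) (hQ : 0 < Q)
    (hlow : ∀ x, a * ‖x‖ ≤ M x) (hup : ∀ x, M x ≤ b * ‖x‖)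
    (hM : ∀ x y, M ((1 / 2 : ℝ) • (x + y)) ^ Q + c * M ((1 / 2 : ℝ) • (x - y)) ^ Q ≤
      ((M x ^ P + M y ^ P) / 2) ^ (Q / P))
    (h : FinitelyRepresentable Y X) : IsReflexiveSpace Y := by
  classical
  have hL : ∀ s : Finset Y, ∃ L : Submodule.span ℝ (s : Set Y) →ₗ[ℝ] X,
      ∀ y, ‖y‖ ≤ ‖L y‖ ∧ ‖L y‖ ≤ 2 * ‖y‖ := fun s => by
    obtain ⟨E, T, hT⟩ := h 1 one_pos (Submodule.span ℝ (s : Set Y))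
      (FiniteDimensional.span_finset ℝ s)
    let A : Submodule.span ℝ (s : Set Y) →L[ℝ] E := T
    let B : E →L[ℝ] Submodule.span ℝ (s : Set Y) := T.symm
    have hAB : ‖A‖ * ‖B‖ ≤ 1 + 1 := hT
    -- Scaling by the norm of the inverse makes the lower constant 1; the upper one becomes `‖A‖ *
    -- ‖B‖ ≤ 2`.
    refine ⟨‖B‖ • (E.subtype ∘ₗ T.toLinearEquiv.toLinearMap), fun y => ?_⟩
    have e : ‖(‖B‖ • (E.subtype ∘ₗ T.toLinearEquiv.toLinearMap)) y‖ = ‖B‖ * ‖T y‖ := by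
      simp [norm_smul, ContinuousLinearMap.opNorm_nonneg]
    rw [e]
    constructor
    · simpa [B] using B.le_opNorm (T y)
    · have h1 : ‖T y‖ ≤ ‖A‖ * ‖y‖ := A.le_opNorm y
      calc ‖B‖ * ‖T y‖ ≤ ‖B‖ * (‖A‖ * ‖y‖) := by gcongr
        _ = ‖A‖ * ‖B‖ * ‖y‖ := by ring
        _ ≤ 2 * ‖y‖ := by gcongr; linarith
  choose L hL using hL
  let N : Finset Y → Y → ℝ := fun s y =>
    -- The value off the span is immaterial: each `y` is eventually in the span.
    if hy : y ∈ Submodule.span ℝ (s : Set Y) then M (L s ⟨y, hy⟩) else a * ‖y‖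
  have hMn : ∀ (s : Finset Y) y, (hy : y ∈ Submodule.span ℝ (s : Set Y)) →
      a * ‖y‖ ≤ M (L s ⟨y, hy⟩) ∧ M (L s ⟨y, hy⟩) ≤ b * (2 * ‖y‖) := fun s y hy =>
    ⟨(mul_le_mul_of_nonneg_left (hL s ⟨y, hy⟩).1 ha.le).trans (hlow _),
      (hup _).trans (mul_le_mul_of_nonneg_left (hL s ⟨y, hy⟩).2 hb)⟩
  have hNIcc : ∀ y, ∀ᶠ s in atTop, N s y ∈ Set.Icc (a * ‖y‖) (b * (2 * ‖y‖)) := fun y => by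
    filter_upwards [eventually_ge_atTop {y}] with s hs
    have hy : y ∈ Submodule.span ℝ (s : Set Y) := Submodule.subset_span (by simpa using hs)
    simp only [N, dif_pos hy]
    exact hMn s y hy
  let U : Ultrafilter (Finset Y) := Ultrafilter.of atTop
  have hU : (U : Filter (Finset Y)) ≤ atTop := Ultrafilter.of_le atTop
  have hlim : ∀ y, ∃ t ∈ Set.Icc (a * ‖y‖) (b * (2 * ‖y‖)),
      Tendsto (fun s => N s y) U (𝓝 t) := fun y =>
    isCompact_Icc.ultrafilter_le_nhds (U.map fun s => N s y) (le_principal_iff.2 (hU (hNIcc y)))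
  choose n hn hnt using hlim
  have hn0 : ∀ y, 0 ≤ n y := fun y => (by positivity : 0 ≤ a * ‖y‖).trans (hn y).1
  refine isReflexiveSpace_of_two_point_inequality n (b := b * 2) ha hc hP hQ (fun y => (hn y).1)
    (fun y => by rw [mul_assoc]; exact (hn y).2) fun x y => ?_
  have h1 : Tendsto (fun s => N s ((1 / 2 : ℝ) • (x + y)) ^ Q +
      c * N s ((1 / 2 : ℝ) • (x - y)) ^ Q) U
      (𝓝 (n ((1 / 2 : ℝ) • (x + y)) ^ Q + c * n ((1 / 2 : ℝ) • (x - y)) ^ Q)) :=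
    ((hnt _).rpow_const (Or.inr hQ.le)).add
      (((hnt _).rpow_const (Or.inr hQ.le)).const_mul c)
  have h2 : Tendsto (fun s => ((N s x ^ P + N s y ^ P) / 2) ^ (Q / P)) U
      (𝓝 (((n x ^ P + n y ^ P) / 2) ^ (Q / P))) :=
    ((((hnt _).rpow_const (Or.inr hP.le)).add
      ((hnt _).rpow_const (Or.inr hP.le))).div_const 2).rpow_const (Or.inr (by positivity))
  refine le_of_tendsto_of_tendsto h1 h2 ?_
  filter_upwards [hU (eventually_ge_atTop {x, y})] with s hs
  have hx : x ∈ Submodule.span ℝ (s : Set Y) := Submodule.subset_span (hs (by simp))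
  have hy : y ∈ Submodule.span ℝ (s : Set Y) := Submodule.subset_span (hs (by simp))
  have hxy := Submodule.smul_mem _ (1 / 2 : ℝ) (add_mem hx hy)
  have hxy' := Submodule.smul_mem _ (1 / 2 : ℝ) (sub_mem hx hy)
  simp only [N, dif_pos hx, dif_pos hy, dif_pos hxy, dif_pos hxy']
  have := hM (L s ⟨x, hx⟩) (L s ⟨y, hy⟩)
  rw [← map_add, ← map_sub, ← map_smul, ← map_smul] at this
  exact this

theorem FinitelyRepresentable.refl : FinitelyRepresentable X X := fun ε hε F _ => by
  refine ⟨F, ContinuousLinearEquiv.refl ℝ F, ?_⟩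
  have h1 : ‖((ContinuousLinearEquiv.refl ℝ F : F ≃L[ℝ] F) : F →L[ℝ] F)‖ ≤ 1 :=
    ContinuousLinearMap.norm_id_le
  have h2 : ‖((ContinuousLinearEquiv.refl ℝ F : F ≃L[ℝ] F).symm : F →L[ℝ] F)‖ ≤ 1 :=
    ContinuousLinearMap.norm_id_le
  have := mul_le_mul h1 h2 (ContinuousLinearMap.opNorm_nonneg _) zero_le_one
  linarith

/-- A reflexive space with a countable separating family of functionals is an Asplund space. -/
theorem IsReflexiveSpace.isAsplundSpace (hX : IsReflexiveSpace X) (e : ℕ → StrongDual ℝ X)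
    (he : ∀ x, (∀ n, e n x = 0) → x = 0) : IsAsplundSpace X := by
  intro Y _
  -- Otherwise a nonzero element of the bidual vanishes on every `e n`; by reflexivity it is a point
  -- of `X`, which must be 0.
  have hD : closure (Submodule.span ℝ (Set.range e) : Set (StrongDual ℝ X)) = Set.univ := by
    by_contra hne
    obtain ⟨f, hf⟩ := (Set.ne_univ_iff_exists_notMem _).1 hne
    obtain ⟨φ, u, hφ, hu⟩ := geometric_hahn_banach_point_closed
      (Submodule.span ℝ (Set.range e)).convex.closure isClosed_closure hf
    have h0 : ∀ b ∈ Submodule.span ℝ (Set.range e), φ b = 0 := fun b hb => by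
      by_contra hb0
      have := hu _ (subset_closure (Submodule.smul_mem _ ((u - 1) / φ b) hb))
      rw [map_smul, smul_eq_mul, div_mul_cancel₀ _ hb0] at this
      linarith
    have hu0 : u < 0 := by simpa using hu 0 (subset_closure (zero_mem _))
    obtain ⟨x, rfl⟩ := hX φ
    have hx : x = 0 := he x fun n => h0 _ (Submodule.subset_span ⟨n, rfl⟩)
    rw [hx, map_zero] at hφ
    simp only [zero_apply] at hφ
    linarith
  have hsep : TopologicalSpace.SeparableSpace (StrongDual ℝ X) := by
    rw [← TopologicalSpace.isSeparable_univ_iff, ← hD]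
    exact ((Set.countable_range e).isSeparable.span).closure
  -- Restriction of functionals to `Y` is onto by Hahn–Banach, so separability descends.
  have hsurj : Function.Surjective ((ContinuousLinearMap.compL ℝ Y X ℝ).flip Y.subtypeL) :=
    fun g => by
      obtain ⟨f, hf, -⟩ := exists_extension_norm_eq Y g
      exact ⟨f, ContinuousLinearMap.ext fun y => hf y⟩
  exact hsurj.denseRange.separableSpace (ContinuousLinearMap.continuous _)

/-- A space that contains a bounded sequence which is bounded below like the unit vector basis of
`ℓ¹` is not an Asplund space. -/
theorem not_isAsplundSpace_of_l1_sequence (y : ℕ → X) {K M : ℝ} (hM : ∀ k, ‖y k‖ ≤ M)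
    (hK : ∀ a : ℕ →₀ ℝ, ∑ k ∈ a.support, |a k| ≤ K * ‖∑ k ∈ a.support, a k • y k‖) :
    ¬ IsAsplundSpace X := by
  classical
  intro hA
  have hli : LinearIndependent ℝ y := linearIndependent_iff.2 fun a ha => by
    have h1 := hK a
    rw [Finsupp.linearCombination_apply, Finsupp.sum] at ha
    rw [ha, norm_zero, mul_zero] at h1
    ext k
    by_contra hk
    have h2 := Finset.single_le_sum (f := fun k => |a k|) (fun i _ => abs_nonneg _)
      (Finsupp.mem_support_iff.2 hk)
    exact hk (abs_nonpos_iff.1 (h2.trans h1))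
  let B := Module.Basis.span hli
  have hsep : TopologicalSpace.SeparableSpace (Submodule.span ℝ (Set.range y)) :=
    ((Set.countable_range y).isSeparable.span).separableSpace
  have := hA _ hsep
  have hB : ∀ k, ((B k : Submodule.span ℝ (Set.range y)) : X) = y k := fun k =>
    congrArg Subtype.val (Module.Basis.span_apply hli k)
  -- The `ℓ¹` bound makes every 0-1 pattern on the `y k` a bounded functional. This gives
  -- uncountably many functionals that are uniformly separated.
  have hbound : ∀ (θ : Set ℕ) (v), ‖B.constr ℝ (fun k => if k ∈ θ then (1 : ℝ) else 0) v‖ ≤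
      K * ‖v‖ := fun θ v => by
    have h1 : (v : X) = ∑ k ∈ (B.repr v).support, B.repr v k • y k := by
      conv_lhs => rw [← B.linearCombination_repr v]
      rw [Finsupp.linearCombination_apply, Finsupp.sum]
      simp [hB]
    have h2 := hK (B.repr v)
    rw [← h1] at h2
    refine le_trans ?_ h2
    rw [Module.Basis.constr_apply, Finsupp.sum]
    refine (norm_sum_le _ _).trans (Finset.sum_le_sum fun k _ => ?_)
    split_ifs <;> simp
  let F : Set ℕ → StrongDual ℝ (Submodule.span ℝ (Set.range y)) := fun θ =>
    (B.constr ℝ (fun k => if k ∈ θ then (1 : ℝ) else 0)).mkContinuous K (hbound θ)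
  have hF : ∀ θ k, F θ (B k) = if k ∈ θ then (1 : ℝ) else 0 := fun θ k => by
    simp [F, Module.Basis.constr_basis]
  have hM0 : 0 < M + 1 := by linarith [(norm_nonneg _).trans (hM 0)]
  have hdist : ∀ θ θ', θ ≠ θ' → 1 / (M + 1) ≤ dist (F θ) (F θ') := fun θ θ' hne => by
    obtain ⟨k, hk⟩ : ∃ k, ¬ (k ∈ θ ↔ k ∈ θ') := by
      by_contra! h
      exact hne (Set.ext h)
    have e : dist (F θ) (F θ') = ‖F θ - F θ'‖ := by exact dist_eq_norm (F θ) (F θ')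
    rw [e, div_le_iff₀ hM0]
    have h1 : ‖(F θ - F θ') (B k)‖ = 1 := by
      rw [sub_apply, hF, hF]
      by_cases h : k ∈ θ <;> by_cases h' : k ∈ θ' <;> simp_all
    have h2 : ‖B k‖ ≤ M + 1 := by
      have h3 : ‖((B k : Submodule.span ℝ (Set.range y)) : X)‖ ≤ M + 1 := by
        rw [hB]
        linarith [hM k]
      exact h3
    calc (1 : ℝ) = ‖(F θ - F θ') (B k)‖ := h1.symm
      _ ≤ ‖F θ - F θ'‖ * ‖B k‖ := (F θ - F θ').le_opNorm _
      _ ≤ _ := by gcongr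
  have hcount : Countable (Set ℕ) := by
    refine Pairwise.countable_of_isOpen_disjoint
      (s := fun θ => Metric.ball (F θ) (1 / (M + 1) / 2)) (fun θ θ' hne => ?_)
      (fun θ => Metric.isOpen_ball) fun θ => ⟨F θ, Metric.mem_ball_self (by positivity)⟩
    refine Metric.ball_disjoint_ball ?_
    rw [add_halves]
    exact hdist θ θ' hne
  obtain ⟨f, hf⟩ := exists_surjective_nat (Set ℕ)
  exact Function.cantor_surjective f hf

end Abstract

/-! ### Two-term sums with real exponents and the mixed Minkowski inequality. -/

/-- `t ⊞_p s` for a finite exponent, given as a real number. -/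
noncomputable def lpAdd (p t s : ℝ) : ℝ := (t ^ p + s ^ p) ^ (1 / p)

section LpAdd

variable {p r t s t' s' : ℝ}

theorem lpAdd_nonneg (ht : 0 ≤ t) (hs : 0 ≤ s) : 0 ≤ lpAdd p t s := by
  unfold lpAdd
  positivity

theorem lpAdd_zero_right (hp : 0 < p) (ht : 0 ≤ t) : lpAdd p t 0 = t := by
  rw [lpAdd, Real.zero_rpow hp.ne', add_zero, ← Real.rpow_mul ht, mul_one_div_cancel hp.ne',
    Real.rpow_one]

theorem lpAdd_zero_left (hp : 0 < p) (ht : 0 ≤ t) : lpAdd p 0 t = t := by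
  rw [lpAdd, add_comm]
  exact lpAdd_zero_right hp ht

theorem lpAdd_rpow (hp : 0 < p) (ht : 0 ≤ t) (hs : 0 ≤ s) : lpAdd p t s ^ p = t ^ p + s ^ p := by
  rw [lpAdd, ← Real.rpow_mul (by positivity), one_div_mul_cancel hp.ne', Real.rpow_one]

theorem lpAdd_mono (hp : 0 < p) (ht : 0 ≤ t) (hs : 0 ≤ s) (h : t ≤ t') (h' : s ≤ s') :
    lpAdd p t s ≤ lpAdd p t' s' := by
  unfold lpAdd
  gcongr

theorem boxPlus_eq_lpAdd {p : ℝ≥0∞} (hp : p ≠ ∞) (t s : ℝ) :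
    boxPlus p t s = lpAdd p.toReal t s := by
  rw [boxPlus, if_neg hp, lpAdd]

/-- Minkowski's inequality for mixed norms of a `2 × 2` matrix. -/
theorem lpAdd_lpAdd_le {a b c d : ℝ} (hp : 0 < p) (hpr : p ≤ r) (ha : 0 ≤ a) (hb : 0 ≤ b)
    (hc : 0 ≤ c) (hd : 0 ≤ d) :
    lpAdd r (lpAdd p a b) (lpAdd p c d) ≤ lpAdd p (lpAdd r a c) (lpAdd r b d) := by
  have hr : 0 < r := hp.trans_le hpr
  have hρ : 1 ≤ r / p := (one_le_div hp).2 hpr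
  -- After raising to the power `p`, the claim is the triangle inequality for exponent `r / p ≥ 1`,
  -- applied to `p`-th powers.
  have hpow : ∀ u v : ℝ, 0 ≤ u → 0 ≤ v →
      lpAdd r u v ^ p = boxPlus (ENNReal.ofReal (r / p)) (u ^ p) (v ^ p) := fun u v hu hv => by
    rw [boxPlus_eq_lpAdd ENNReal.ofReal_ne_top, ENNReal.toReal_ofReal (by positivity), lpAdd, lpAdd,
      ← Real.rpow_mul hu, ← Real.rpow_mul hv, mul_div_cancel₀ _ hp.ne',
      ← Real.rpow_mul (by positivity)]
    congr 1
    field_simp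
  rw [← Real.rpow_le_rpow_iff (lpAdd_nonneg (lpAdd_nonneg ha hb) (lpAdd_nonneg hc hd))
    (lpAdd_nonneg (lpAdd_nonneg ha hc) (lpAdd_nonneg hb hd)) hp,
    hpow _ _ (lpAdd_nonneg ha hb) (lpAdd_nonneg hc hd), lpAdd_rpow hp ha hb, lpAdd_rpow hp hc hd,
    lpAdd_rpow hp (lpAdd_nonneg ha hc) (lpAdd_nonneg hb hd), hpow _ _ ha hc, hpow _ _ hb hd]
  exact boxPlus_add_le (by simpa using ENNReal.ofReal_le_ofReal hρ) (by positivity) (by positivity)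
    (by positivity) (by positivity)

end LpAdd

/-! ### The scalar two-point inequality. -/

section Scalar

/-- The difference of the sides has nonnegative derivative, by AM-GM: `(1 + x) ^ (θ - 1)` and `(1 -
x) ^ (θ - 1)` have product at least 1. -/
theorem two_mul_le_rpow_sub_rpow {θ b : ℝ} (hθ : 0 < θ) (hθ1 : θ ≤ 1) (hb : b ∈ Set.Icc (0 : ℝ) 1) :
    2 * θ * b ≤ (1 + b) ^ θ - (1 - b) ^ θ := by
  let f : ℝ → ℝ := fun b => (1 + b) ^ θ - (1 - b) ^ θ - 2 * θ * b
  have hd : ∀ x ∈ interior (Set.Icc (0 : ℝ) 1), HasDerivWithinAt f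
      (θ * (1 + x) ^ (θ - 1) + θ * (1 - x) ^ (θ - 1) - 2 * θ) (interior (Set.Icc (0 : ℝ) 1)) x := by
    intro x hx
    rw [interior_Icc] at hx
    have h1 : HasDerivAt (fun b : ℝ => (1 + b) ^ θ) (1 * θ * (1 + x) ^ (θ - 1)) x :=
      ((hasDerivAt_id x).const_add 1).rpow_const (Or.inl (by simp; linarith [hx.1]))
    have h2 : HasDerivAt (fun b : ℝ => (1 - b) ^ θ) ((-1) * θ * (1 - x) ^ (θ - 1)) x :=
      ((hasDerivAt_id x).const_sub 1).rpow_const (Or.inl (by simp; linarith [hx.2]))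
    have h3 := (h1.sub h2).sub ((hasDerivAt_id x).const_mul (2 * θ))
    refine (h3.congr_deriv ?_).hasDerivWithinAt
    ring
  have hmono : MonotoneOn f (Set.Icc 0 1) := by
    refine monotoneOn_of_hasDerivWithinAt_nonneg (convex_Icc 0 1) ?_ hd ?_
    · refine ContinuousOn.sub (ContinuousOn.sub ?_ ?_) (by fun_prop)
      · exact (continuous_const.add continuous_id).continuousOn.rpow_const fun _ _ => Or.inr hθ.le
      · exact (continuous_const.sub continuous_id).continuousOn.rpow_const fun _ _ => Or.inr hθ.le
    · intro x hx
      rw [interior_Icc] at hx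
      have hx0 := hx.1
      have hx1 := hx.2
      have hA : 0 < (1 + x) ^ (θ - 1) := Real.rpow_pos_of_pos (by linarith) _
      have hB : 0 < (1 - x) ^ (θ - 1) := Real.rpow_pos_of_pos (by linarith) _
      have hAB : 1 ≤ (1 + x) ^ (θ - 1) * (1 - x) ^ (θ - 1) := by
        rw [← Real.mul_rpow (by linarith) (by linarith)]
        exact Real.one_le_rpow_of_pos_of_le_one_of_nonpos (by nlinarith) (by nlinarith)
          (by linarith)
      have : 2 ≤ (1 + x) ^ (θ - 1) + (1 - x) ^ (θ - 1) := by
        nlinarith [sq_nonneg ((1 + x) ^ (θ - 1) - (1 - x) ^ (θ - 1))]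
      nlinarith
  have := hmono (Set.left_mem_Icc.2 zero_le_one) hb hb.1
  simp only [f, add_zero, sub_zero, mul_zero, sub_self] at this
  linarith

/-- Differentiating in `b` reduces this to the preceding inequality with `θ = P - 1`. -/
theorem one_add_mul_sq_le_rpow_mean {P b : ℝ} (hP : 1 < P) (hP2 : P ≤ 2)
    (hb : b ∈ Set.Icc (0 : ℝ) 1) :
    1 + P * (P - 1) / 2 * b ^ 2 ≤ ((1 + b) ^ P + (1 - b) ^ P) / 2 := by
  let f : ℝ → ℝ := fun b => (1 + b) ^ P + (1 - b) ^ P - P * (P - 1) * b ^ 2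
  have hd : ∀ x ∈ interior (Set.Icc (0 : ℝ) 1), HasDerivWithinAt f
      (P * ((1 + x) ^ (P - 1) - (1 - x) ^ (P - 1) - 2 * (P - 1) * x))
      (interior (Set.Icc (0 : ℝ) 1)) x := by
    intro x hx
    have h1 : HasDerivAt (fun b : ℝ => (1 + b) ^ P) (1 * P * (1 + x) ^ (P - 1)) x :=
      ((hasDerivAt_id x).const_add 1).rpow_const (Or.inr hP.le)
    have h2 : HasDerivAt (fun b : ℝ => (1 - b) ^ P) ((-1) * P * (1 - x) ^ (P - 1)) x :=
      ((hasDerivAt_id x).const_sub 1).rpow_const (Or.inr hP.le)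
    have h3 := (h1.add h2).sub ((hasDerivAt_pow 2 x).const_mul (P * (P - 1)))
    refine (h3.congr_deriv ?_).hasDerivWithinAt
    push_cast
    ring
  have hP0 : 0 ≤ P := by linarith
  have hmono : MonotoneOn f (Set.Icc 0 1) := by
    refine monotoneOn_of_hasDerivWithinAt_nonneg (convex_Icc 0 1) ?_ hd ?_
    · refine ContinuousOn.sub (ContinuousOn.add ?_ ?_) (by fun_prop)
      · exact (continuous_const.add continuous_id).continuousOn.rpow_const fun _ _ => Or.inr hP0
      · exact (continuous_const.sub continuous_id).continuousOn.rpow_const fun _ _ => Or.inr hP0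
    · intro x hx
      have := two_mul_le_rpow_sub_rpow (θ := P - 1) (by linarith) (by linarith)
        (interior_subset hx)
      exact mul_nonneg hP0 (by linarith)
  have := hmono (Set.left_mem_Icc.2 zero_le_one) hb hb.1
  simp only [f, add_zero, sub_zero, Real.one_rpow] at this
  norm_num at this
  linarith

/-- By homogeneity `m = 1` and `n = b ≤ 1`. Then `b ^ Q ≤ b ^ 2`, and the power `Q / P ≥ 1` only
increases numbers that are at least 1. -/
theorem rpow_add_mul_rpow_le {P Q m n : ℝ} (hP : 1 < P) (hP2 : P ≤ 2) (hQ : 2 ≤ Q) (hn : 0 ≤ n)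
    (hnm : n ≤ m) :
    m ^ Q + P * (P - 1) / 2 * n ^ Q ≤ (((m + n) ^ P + (m - n) ^ P) / 2) ^ (Q / P) := by
  have hP0 : 0 < P := by linarith
  have hQ0 : 0 < Q := by linarith
  rcases (hn.trans hnm).eq_or_lt with rfl | hm
  · obtain rfl : n = 0 := le_antisymm hnm hn
    simp [Real.zero_rpow hP0.ne', Real.zero_rpow hQ0.ne',
      Real.zero_rpow (div_pos hQ0 hP0).ne']
  have hγ : 0 ≤ P * (P - 1) / 2 := by nlinarith
  obtain ⟨b, rfl⟩ : ∃ b, n = m * b := ⟨n / m, (mul_div_cancel₀ _ hm.ne').symm⟩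
  have hb0 : 0 ≤ b := nonneg_of_mul_nonneg_right hn hm
  have hb1 : b ≤ 1 := by nlinarith
  have h1 := one_add_mul_sq_le_rpow_mean hP hP2 ⟨hb0, hb1⟩
  have h2 : b ^ Q ≤ b ^ 2 := by
    rw [← Real.rpow_natCast b 2]
    exact Real.rpow_le_rpow_of_exponent_ge_of_imp hb0 hb1 (by simpa using hQ)
      (fun _ h => absurd h hQ0.ne')
  have e : ((m + m * b) ^ P + (m - m * b) ^ P) / 2 = m ^ P * (((1 + b) ^ P + (1 - b) ^ P) / 2) := by
    rw [show m + m * b = m * (1 + b) by ring, show m - m * b = m * (1 - b) by ring,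
      Real.mul_rpow hm.le (by linarith), Real.mul_rpow hm.le (by linarith)]
    ring
  rw [e, Real.mul_rpow hm.le hb0,
    Real.mul_rpow (by positivity) (by linarith [show 0 ≤ P * (P - 1) / 2 * b ^ 2 by positivity]),
    ← Real.rpow_mul hm.le, mul_div_cancel₀ _ hP0.ne']
  calc m ^ Q + P * (P - 1) / 2 * (m ^ Q * b ^ Q) = m ^ Q * (1 + P * (P - 1) / 2 * b ^ Q) := by ring
    _ ≤ m ^ Q * (1 + P * (P - 1) / 2 * b ^ 2) := by gcongr
    _ ≤ m ^ Q * (1 + P * (P - 1) / 2 * b ^ 2) ^ (Q / P) := by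
        gcongr
        refine Real.self_le_rpow_of_one_le ?_ ((one_le_div hP0).2 (by linarith))
        linarith [show 0 ≤ P * (P - 1) / 2 * b ^ 2 by positivity]
    _ ≤ _ := by gcongr

theorem two_point_inequality {P Q : ℝ} (hP : 1 < P) (hP2 : P ≤ 2) (hQ : 2 ≤ Q) (s t : ℝ) :
    |1 / 2 * (s + t)| ^ Q + P * (P - 1) / 2 * |1 / 2 * (s - t)| ^ Q ≤
      ((|s| ^ P + |t| ^ P) / 2) ^ (Q / P) := by
  have hγ : 0 ≤ P * (P - 1) / 2 := by nlinarith
  have hγ1 : P * (P - 1) / 2 ≤ 1 := by nlinarith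
  obtain ⟨a, ha⟩ : ∃ a, a = 1 / 2 * (s + t) := ⟨_, rfl⟩
  obtain ⟨b, hb⟩ : ∃ b, b = 1 / 2 * (s - t) := ⟨_, rfl⟩
  obtain rfl : s = a + b := by linarith
  obtain rfl : t = a - b := by linarith
  rw [← ha, ← hb]
  have hsum : |a + b| ^ P + |a - b| ^ P = (|a| + |b|) ^ P + |(|a| - |b|)| ^ P := by
    rcases abs_cases a with h | h <;> rcases abs_cases b with h' | h' <;> rw [h.1, h'.1]
    · rw [abs_of_nonneg (add_nonneg h.2 h'.2)]
    · rw [← sub_eq_add_neg, sub_neg_eq_add, abs_of_nonneg (show 0 ≤ a - b by linarith), add_comm]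
    · rw [show -a + b = -(a - b) by ring, show -a - b = -(a + b) by ring, abs_neg,
        abs_of_nonpos (show a - b ≤ 0 by linarith), add_comm]
    · rw [show -a + -b = -(a + b) by ring, show -a - -b = -(a - b) by ring, abs_neg,
        abs_of_neg (show a + b < 0 by linarith)]
  rw [hsum]
  have hQ0 : 0 ≤ Q := by linarith
  rcases le_total |b| |a| with h | h
  · have := rpow_add_mul_rpow_le hP hP2 hQ (abs_nonneg b) h
    rwa [abs_of_nonneg (sub_nonneg.2 h)]
  -- With the roles of `a` and `b` exchanged the left side is at least as large, since the constant
  -- is at most 1.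
  · have h1 := rpow_add_mul_rpow_le hP hP2 hQ (abs_nonneg a) h
    have h2 := Real.rpow_le_rpow (abs_nonneg a) h hQ0
    rw [abs_of_nonpos (sub_nonpos.2 h), neg_sub, add_comm |a|]
    nlinarith

end Scalar

/-! ### Inequalities for the seminorms. -/

section Sequences

variable {p p' : ℕ → Set.Icc (1 : ℝ≥0∞) ∞}

theorem boxPlus_zero_right {p : ℝ≥0∞} (hp : 1 ≤ p) {t : ℝ} (ht : 0 ≤ t) : boxPlus p t 0 = t := by
  by_cases h : p = ∞
  · rw [boxPlus, if_pos h, max_eq_left ht]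
  · rw [boxPlus_eq_lpAdd h, lpAdd_zero_right (by linarith [toReal_one_le hp h]) ht]

theorem boxPlus_le_add {p : ℝ≥0∞} (hp : 1 ≤ p) {t s : ℝ} (ht : 0 ≤ t) (hs : 0 ≤ s) :
    boxPlus p t s ≤ t + s := by
  have := boxPlus_add_le hp ht le_rfl le_rfl hs
  rwa [add_zero, zero_add, boxPlus_zero_right hp ht, boxPlus_comm p 0 s,
    boxPlus_zero_right hp hs] at this

theorem partialNorm_zero (k : ℕ) : partialNorm p 0 k = 0 := by
  simpa using partialNorm_smul p 0 0 k

theorem partialNorm_le_sum (x : ℕ → ℝ) (k : ℕ) :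
    partialNorm p x k ≤ ∑ i ∈ Finset.range (k + 1), |x i| := by
  induction k with
  | zero => simp [partialNorm]
  | succ k ih =>
    rw [Finset.sum_range_succ]
    exact (boxPlus_le_add (p k).2.1 (partialNorm_nonneg p x k) (abs_nonneg _)).trans (by gcongr)

/-- Any two of the operations `⊞` differ by a factor of at most 2, as both lie between the maximum
and the sum. Only the first `m` steps cost this factor. -/
theorem partialNorm_le_two_pow_mul {m : ℕ} (h : ∀ n, m ≤ n → p n = p' n) (x : ℕ → ℝ) (k : ℕ) :
    partialNorm p x k ≤ 2 ^ m * partialNorm p' x k := by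
  have main : ∀ k, partialNorm p x k ≤ 2 ^ min k m * partialNorm p' x k := fun k => by
    induction k with
    | zero => simp [partialNorm]
    | succ k ih =>
      have h0 := partialNorm_nonneg p x k
      have h0' := partialNorm_nonneg p' x k
      have hx := abs_nonneg (x (k + 1))
      have h1 : (1 : ℝ) ≤ 2 ^ min k m := one_le_pow₀ one_le_two
      rcases lt_or_ge k m with hk | hk
      · have e : min (k + 1) m = min k m + 1 := by omega
        rw [e, pow_succ, partialNorm, partialNorm]
        have h2 := boxPlus_le_add (p k).2.1 h0 hx
        have h3 := left_le_boxPlus (p' k).2.1 h0' hx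
        have h4 := right_le_boxPlus (p' k).2.1 h0' hx
        nlinarith
      · have e : min (k + 1) m = min k m := by omega
        rw [e, partialNorm, partialNorm, h k hk]
        rw [← boxPlus_mul (p' k).2.1 (by positivity) h0' hx]
        exact boxPlus_mono _ h0 hx ih (by nlinarith)
  refine (main k).trans ?_
  have := partialNorm_nonneg p' x k
  gcongr
  · exact one_le_two
  · exact min_le_right _ _

/-- A pointwise inequality between an `ℓ^Q`-sum and an `ℓ^P`-sum passes to the seminorms, when all
exponents lie between `P` and `Q`. -/
theorem lpAdd_partialNorm_le {P Q : ℝ} (hP : 0 < P)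
    (hp : ∀ n, ENNReal.ofReal P ≤ p n ∧ (p n : ℝ≥0∞) ≤ ENNReal.ofReal Q) {u v x y : ℕ → ℝ}
    (h : ∀ n, lpAdd Q |u n| |v n| ≤ lpAdd P |x n| |y n|) (k : ℕ) :
    lpAdd Q (partialNorm p u k) (partialNorm p v k) ≤
      lpAdd P (partialNorm p x k) (partialNorm p y k) := by
  induction k with
  | zero => exact h 0
  | succ k ih =>
    have hr : (p k : ℝ≥0∞) ≠ ∞ := ((hp k).2.trans_lt ENNReal.ofReal_lt_top).ne
    have hPr : P ≤ (p k : ℝ≥0∞).toReal := (ENNReal.ofReal_le_iff_le_toReal hr).1 (hp k).1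
    have hr0 : 0 < (p k : ℝ≥0∞).toReal := hP.trans_le hPr
    have hrQ : (p k : ℝ≥0∞).toReal ≤ Q := by
      have hQ : 0 ≤ Q := by
        by_contra! hQ
        have := (p k).2.1.trans (hp k).2
        rw [ENNReal.ofReal_of_nonpos hQ.le] at this
        simp at this
      exact ENNReal.toReal_le_of_le_ofReal hQ (hp k).2
    simp only [partialNorm, boxPlus_eq_lpAdd hr]
    have hu := partialNorm_nonneg p u k
    have hv := partialNorm_nonneg p v k
    have hx := partialNorm_nonneg p x k
    have hy := partialNorm_nonneg p y k
    -- Minkowski is used twice: with `p k ≤ Q` on the left and with `P ≤ p k` on the right.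
    calc _ ≤ lpAdd (p k : ℝ≥0∞).toReal (lpAdd Q (partialNorm p u k) (partialNorm p v k))
          (lpAdd Q |u (k + 1)| |v (k + 1)|) :=
          lpAdd_lpAdd_le hr0 hrQ hu (abs_nonneg _) hv (abs_nonneg _)
      _ ≤ lpAdd (p k : ℝ≥0∞).toReal (lpAdd P (partialNorm p x k) (partialNorm p y k))
          (lpAdd P |x (k + 1)| |y (k + 1)|) :=
          lpAdd_mono hr0 (lpAdd_nonneg hu hv) (lpAdd_nonneg (abs_nonneg _) (abs_nonneg _)) ih (h _)
      _ ≤ _ := lpAdd_lpAdd_le hP hPr hx hy (abs_nonneg _) (abs_nonneg _)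

theorem partialNorm_two_point_inequality {P Q : ℝ} (hP : 1 < P) (hP2 : P ≤ 2) (hQ : 2 ≤ Q)
    (hp : ∀ n, ENNReal.ofReal P ≤ p n ∧ (p n : ℝ≥0∞) ≤ ENNReal.ofReal Q) (x y : ℕ → ℝ) (k : ℕ) :
    partialNorm p ((1 / 2 : ℝ) • (x + y)) k ^ Q +
        P * (P - 1) / 2 * partialNorm p ((1 / 2 : ℝ) • (x - y)) k ^ Q ≤
      ((partialNorm p x k ^ P + partialNorm p y k ^ P) / 2) ^ (Q / P) := by
  have hP0 : 0 < P := by linarith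
  have hQ0 : 0 < Q := by linarith
  have hγ : 0 ≤ P * (P - 1) / 2 := by nlinarith
  -- The factors `g` and `h` absorb the two constants into the vectors, leaving a pure inequality
  -- between an `ℓ^Q`-sum and an `ℓ^P`-sum.
  obtain ⟨g, hg, hgQ⟩ : ∃ g : ℝ, 0 ≤ g ∧ g ^ Q = P * (P - 1) / 2 :=
    ⟨(P * (P - 1) / 2) ^ (1 / Q), by positivity, by
      rw [← Real.rpow_mul hγ, one_div_mul_cancel hQ0.ne', Real.rpow_one]⟩
  obtain ⟨h, hh, hhP⟩ : ∃ h : ℝ, 0 ≤ h ∧ h ^ P = 1 / 2 :=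
    ⟨(1 / 2) ^ (1 / P), by positivity, by
      rw [← Real.rpow_mul (by norm_num), one_div_mul_cancel hP0.ne', Real.rpow_one]⟩
  have key : ∀ a b c d : ℝ, 0 ≤ a → 0 ≤ b → 0 ≤ c → 0 ≤ d →
      (lpAdd Q a (g * b) ≤ lpAdd P (h * c) (h * d) ↔
        a ^ Q + P * (P - 1) / 2 * b ^ Q ≤ ((c ^ P + d ^ P) / 2) ^ (Q / P)) := by
    intro a b c d ha hb hc hd
    rw [← Real.rpow_le_rpow_iff (lpAdd_nonneg ha (by positivity))
      (lpAdd_nonneg (by positivity) (by positivity)) hQ0, lpAdd_rpow hQ0 ha (by positivity),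
      Real.mul_rpow hg hb, hgQ, lpAdd, Real.mul_rpow hh hc, Real.mul_rpow hh hd, hhP,
      show 1 / 2 * c ^ P + 1 / 2 * d ^ P = (c ^ P + d ^ P) / 2 by ring,
      ← Real.rpow_mul (by positivity), one_div_mul_eq_div]
  have := lpAdd_partialNorm_le hP0 hp (u := (1 / 2 : ℝ) • (x + y))
    (v := g • (1 / 2 : ℝ) • (x - y)) (x := h • x) (y := h • y) (fun n => by
      have := (key _ _ _ _ (abs_nonneg _) (abs_nonneg _) (abs_nonneg (x n)) (abs_nonneg (y n))).2
        (two_point_inequality hP hP2 hQ (x n) (y n))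
      simpa [abs_mul, abs_of_nonneg hg, abs_of_nonneg hh] using this) k
  rw [partialNorm_smul p g, partialNorm_smul p h, partialNorm_smul p h, abs_of_nonneg hg,
    abs_of_nonneg hh] at this
  exact (key _ _ _ _ (partialNorm_nonneg p _ k) (partialNorm_nonneg p _ k)
    (partialNorm_nonneg p x k) (partialNorm_nonneg p y k)).1 this

theorem exponent_pos_of_bounds {P Q : ℝ}
    (hp : ∀ n, ENNReal.ofReal P ≤ p n ∧ (p n : ℝ≥0∞) ≤ ENNReal.ofReal Q) : 0 < Q := by
  have h1 := (p 0).2.1.trans (hp 0).2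
  exact ENNReal.ofReal_pos.1 (zero_lt_one.trans_le h1)

/-- Transfer principle with `v = 0`: by disjointness, both sides of the pointwise inequality equal
`|x n + y n|`. The lower bound that follows is symmetric. -/
theorem partialNorm_add_rpow_le {P Q : ℝ} (hP : 0 < P)
    (hp : ∀ n, ENNReal.ofReal P ≤ p n ∧ (p n : ℝ≥0∞) ≤ ENNReal.ofReal Q) {x y : ℕ → ℝ}
    (h : ∀ n, x n = 0 ∨ y n = 0) (k : ℕ) :
    partialNorm p (x + y) k ^ P ≤ partialNorm p x k ^ P + partialNorm p y k ^ P := by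
  have hQ := exponent_pos_of_bounds hp
  have := lpAdd_partialNorm_le hP hp (u := x + y) (v := 0) (x := x) (y := y) (fun n => by
    simp only [Pi.zero_apply, abs_zero, lpAdd_zero_right hQ (abs_nonneg _), Pi.add_apply]
    rcases h n with h | h <;> rw [h] <;>
      simp [lpAdd_zero_right hP (abs_nonneg _), lpAdd_zero_left hP (abs_nonneg _)]) k
  rw [partialNorm_zero, lpAdd_zero_right hQ (partialNorm_nonneg p _ k)] at this
  rw [← lpAdd_rpow hP (partialNorm_nonneg p _ k) (partialNorm_nonneg p _ k)]
  exact Real.rpow_le_rpow (partialNorm_nonneg p _ k) this hP.le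

theorem rpow_add_le_partialNorm_add_rpow {P Q : ℝ} (hP : 0 < P)
    (hp : ∀ n, ENNReal.ofReal P ≤ p n ∧ (p n : ℝ≥0∞) ≤ ENNReal.ofReal Q) {x y : ℕ → ℝ}
    (h : ∀ n, x n = 0 ∨ y n = 0) (k : ℕ) :
    partialNorm p x k ^ Q + partialNorm p y k ^ Q ≤ partialNorm p (x + y) k ^ Q := by
  have hQ := exponent_pos_of_bounds hp
  have := lpAdd_partialNorm_le hP hp (u := x) (v := y) (x := x + y) (y := 0) (fun n => by
    simp only [Pi.zero_apply, abs_zero, lpAdd_zero_right hP (abs_nonneg _), Pi.add_apply]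
    rcases h n with h | h <;> rw [h] <;>
      simp [lpAdd_zero_right hQ (abs_nonneg _), lpAdd_zero_left hQ (abs_nonneg _)]) k
  rw [partialNorm_zero, lpAdd_zero_right hP (partialNorm_nonneg p _ k)] at this
  rw [← lpAdd_rpow hQ (partialNorm_nonneg p _ k) (partialNorm_nonneg p _ k)]
  exact Real.rpow_le_rpow (lpAdd_nonneg (partialNorm_nonneg p _ k) (partialNorm_nonneg p _ k))
    this hQ.le

theorem sum_apply_eq_zero_or {ι : Type*} {x : ι → ℕ → ℝ}
    (hx : ∀ i j, i ≠ j → ∀ n, x i n = 0 ∨ x j n = 0) {i : ι} {s : Finset ι} (hi : i ∉ s) (n : ℕ) :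
    x i n = 0 ∨ (∑ j ∈ s, x j) n = 0 := by
  refine or_iff_not_imp_left.2 fun h => ?_
  rw [Finset.sum_apply]
  exact Finset.sum_eq_zero fun j hj =>
    (hx i j (fun e => hi (e ▸ hj)) n).resolve_left h

theorem partialNorm_sum_rpow_le {ι : Type*} {P Q : ℝ} (hP : 0 < P)
    (hp : ∀ n, ENNReal.ofReal P ≤ p n ∧ (p n : ℝ≥0∞) ≤ ENNReal.ofReal Q) {x : ι → ℕ → ℝ}
    (hx : ∀ i j, i ≠ j → ∀ n, x i n = 0 ∨ x j n = 0) (s : Finset ι) (k : ℕ) :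
    partialNorm p (∑ i ∈ s, x i) k ^ P ≤ ∑ i ∈ s, partialNorm p (x i) k ^ P := by
  classical
  induction s using Finset.induction with
  | empty => simp [partialNorm_zero, Real.zero_rpow hP.ne']
  | insert i s hi ih =>
    rw [Finset.sum_insert hi, Finset.sum_insert hi]
    exact (partialNorm_add_rpow_le hP hp (sum_apply_eq_zero_or hx hi) k).trans (by gcongr)

theorem sum_rpow_le_partialNorm_sum {ι : Type*} {P Q : ℝ} (hP : 0 < P)
    (hp : ∀ n, ENNReal.ofReal P ≤ p n ∧ (p n : ℝ≥0∞) ≤ ENNReal.ofReal Q) {x : ι → ℕ → ℝ}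
    (hx : ∀ i j, i ≠ j → ∀ n, x i n = 0 ∨ x j n = 0) (s : Finset ι) (k : ℕ) :
    ∑ i ∈ s, partialNorm p (x i) k ^ Q ≤ partialNorm p (∑ i ∈ s, x i) k ^ Q := by
  classical
  have hQ := exponent_pos_of_bounds hp
  induction s using Finset.induction with
  | empty => simp [partialNorm_zero, Real.zero_rpow hQ.ne']
  | insert i s hi ih =>
    rw [Finset.sum_insert hi, Finset.sum_insert hi]
    exact le_trans (by gcongr)
      (rpow_add_le_partialNorm_add_rpow hP hp (sum_apply_eq_zero_or hx hi) k)

theorem add_le_two_rpow_mul_boxPlus {p : ℝ≥0∞} (hp : 1 ≤ p) (hp' : p ≠ ∞) {t s : ℝ} (ht : 0 ≤ t)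
    (hs : 0 ≤ s) : t + s ≤ 2 ^ (1 - 1 / p.toReal) * boxPlus p t s := by
  have h1 := toReal_one_le hp hp'
  have h0 : 0 < p.toReal := by linarith
  rw [boxPlus_eq_lpAdd hp', ← Real.rpow_le_rpow_iff (by positivity)
    (mul_nonneg (by positivity) (lpAdd_nonneg ht hs)) h0, Real.mul_rpow (by positivity)
    (lpAdd_nonneg ht hs), lpAdd_rpow h0 ht hs, ← Real.rpow_mul zero_le_two, sub_mul, one_mul,
    one_div_mul_cancel h0.ne']
  lift t to NNReal using ht
  lift s to NNReal using hs
  exact_mod_cast NNReal.rpow_add_le_mul_rpow_add_rpow t s h1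

theorem boxPlus_le_two_rpow_mul_max {p : ℝ≥0∞} (hp : 1 ≤ p) {t s : ℝ} (ht : 0 ≤ t) (hs : 0 ≤ s) :
    boxPlus p t s ≤ 2 ^ (1 / p.toReal) * max t s := by
  by_cases hp' : p = ∞
  -- Here `1 / p.toReal` is `1 / 0 = 0`, which is the right value of `1 / ∞`.
  · simp [boxPlus, hp']
  have h1 := toReal_one_le hp hp'
  have h0 : 0 < p.toReal := by linarith
  have hm : 0 ≤ max t s := le_max_of_le_left ht
  refine (boxPlus_mono p ht hs (le_max_left t s) (le_max_right t s)).trans_eq ?_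
  rw [boxPlus_eq_lpAdd hp', lpAdd, ← two_mul, Real.mul_rpow zero_le_two (by positivity),
    ← Real.rpow_mul hm, mul_one_div_cancel h0.ne', Real.rpow_one]

/-- Adjoining a coordinate with exponent `r` loses at most `2 ^ (1 - 1 / r)` against the sum, and a
zero coordinate loses nothing. The losses multiply, so their exponents add up. -/
theorem sum_abs_le_two_rpow_mul_partialNorm {d : ℕ → ℝ} (hd : ∀ n, 0 ≤ d n) {x : ℕ → ℝ}
    (hx : ∀ j, x (j + 1) = 0 ∨
      ((p j : ℝ≥0∞) ≠ ∞ ∧ 1 - 1 / (p j : ℝ≥0∞).toReal ≤ d j)) (k : ℕ) :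
    ∑ i ∈ Finset.range (k + 1), |x i| ≤ 2 ^ (∑ j ∈ Finset.range k, d j) * partialNorm p x k := by
  induction k with
  | zero => simp [partialNorm]
  | succ k ih =>
    have h0 := partialNorm_nonneg p x k
    have hD : 0 ≤ ∑ j ∈ Finset.range k, d j := Finset.sum_nonneg fun j _ => hd j
    have hD1 : (1 : ℝ) ≤ 2 ^ (∑ j ∈ Finset.range k, d j) := Real.one_le_rpow one_le_two hD
    rw [Finset.sum_range_succ, Finset.sum_range_succ d, Real.rpow_add two_pos, mul_assoc]
    have h2 : partialNorm p x k + |x (k + 1)| ≤ 2 ^ d k * partialNorm p x (k + 1) := by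
      have h1 := partialNorm_nonneg p x (k + 1)
      rcases hx k with h | ⟨h, h'⟩
      · have h3 : (1 : ℝ) ≤ 2 ^ d k := Real.one_le_rpow one_le_two (hd k)
        have h4 := partialNorm_monotone p x (Nat.le_succ k)
        rw [h, abs_zero, add_zero]
        exact h4.trans (le_mul_of_one_le_left h1 h3)
      · refine (add_le_two_rpow_mul_boxPlus (p k).2.1 h h0 (abs_nonneg _)).trans ?_
        refine mul_le_mul_of_nonneg_right ?_ h1
        exact Real.rpow_le_rpow_of_exponent_le one_le_two h'
    have h3 := abs_nonneg (x (k + 1))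
    calc _ ≤ 2 ^ (∑ j ∈ Finset.range k, d j) * (partialNorm p x k + |x (k + 1)|) := by nlinarith
      _ ≤ _ := by gcongr

/-- The counterpart for `ℓ^∞`: exponent `r` exceeds the maximum by a factor of at most `2 ^ (1 /
r)`. -/
theorem partialNorm_le_two_rpow {d : ℕ → ℝ} (hd : ∀ n, 0 ≤ d n) {x : ℕ → ℝ} (hx1 : ∀ n, |x n| ≤ 1)
    (hx : ∀ j, x (j + 1) = 0 ∨ 1 / (p j : ℝ≥0∞).toReal ≤ d j) (k : ℕ) :
    partialNorm p x k ≤ 2 ^ (∑ j ∈ Finset.range k, d j) := by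
  induction k with
  | zero => simpa [partialNorm] using hx1 0
  | succ k ih =>
    have h0 := partialNorm_nonneg p x k
    have hD : 0 ≤ ∑ j ∈ Finset.range k, d j := Finset.sum_nonneg fun j _ => hd j
    have hD1 : (1 : ℝ) ≤ 2 ^ (∑ j ∈ Finset.range k, d j) := Real.one_le_rpow one_le_two hD
    have h3 : (1 : ℝ) ≤ 2 ^ d k := Real.one_le_rpow one_le_two (hd k)
    rw [Finset.sum_range_succ, Real.rpow_add two_pos, mul_comm]
    rcases hx k with h | h
    · rw [partialNorm, h, abs_zero, boxPlus_zero_right (p k).2.1 h0]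
      exact ih.trans (le_mul_of_one_le_left (by positivity) h3)
    · refine (boxPlus_le_two_rpow_mul_max (p k).2.1 h0 (abs_nonneg _)).trans ?_
      gcongr
      · exact one_le_two
      · exact max_le ih ((hx1 _).trans hD1)

end Sequences

/-! ### Coordinates and completeness of the space. -/

namespace VarLp

variable {p p' : ℕ → Set.Icc (1 : ℝ≥0∞) ∞}

/-- A sequence with bounded seminorms, as an element of the space. -/
def ofBound (x : ℕ → ℝ) (C : ℝ) (h : ∀ k, partialNorm p x k ≤ C) : VarLp p :=
  ⟨x, ⟨C, by rintro _ ⟨n, rfl⟩; exact (abs_le_partialNorm p x n).trans (h n)⟩,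
    ⟨C, by rintro _ ⟨n, rfl⟩; exact h n⟩⟩

theorem seq_ofBound (x : ℕ → ℝ) (C : ℝ) (h : ∀ k, partialNorm p x k ≤ C) :
    (ofBound x C h).seq = x := rfl

theorem norm_ofBound_le (x : ℕ → ℝ) (C : ℝ) (h : ∀ k, partialNorm p x k ≤ C) :
    ‖ofBound x C h‖ ≤ C := ciSup_le h

theorem seq_sub (x y : VarLp p) : (x - y).seq = x.seq - y.seq := rfl

theorem abs_seq_le_norm (x : VarLp p) (n : ℕ) : |x.seq n| ≤ ‖x‖ :=
  (abs_le_partialNorm p x.seq n).trans (x.partialNorm_le_norm n)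

/-- The linear map that takes an element to its underlying sequence. -/
def seqₗ : VarLp p →ₗ[ℝ] (ℕ → ℝ) where
  toFun := seq
  map_add' := seq_add
  map_smul' := seq_smul

theorem seq_sum {ι : Type*} (s : Finset ι) (x : ι → VarLp p) :
    (∑ i ∈ s, x i).seq = ∑ i ∈ s, (x i).seq :=
  map_sum (seqₗ (p := p)) x s

/-- The coordinate functionals. -/
noncomputable def coord (n : ℕ) : StrongDual ℝ (VarLp p) :=
  (LinearMap.proj n ∘ₗ seqₗ).mkContinuous 1 fun x => by
    rw [one_mul]
    exact x.abs_seq_le_norm n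

theorem eq_zero_of_coord_eq_zero (x : VarLp p) (h : ∀ n, coord n x = 0) : x = 0 :=
  seq_injective (funext h)

/-- Each seminorm sees finitely many coordinates, so the Cauchy bound survives the coordinatewise
limit, uniformly in `k`. -/
instance : CompleteSpace (VarLp p) := by
  refine Metric.complete_of_cauchySeq_tendsto fun u hu => ?_
  have hcoord : ∀ i, ∃ z, Tendsto (fun n => (u n).seq i) atTop (𝓝 z) := fun i =>
    cauchySeq_tendsto_of_complete
      ((coord (p := p) i).uniformContinuous.comp_cauchySeq hu)
  choose z hz using hcoord
  have key : ∀ ε, 0 < ε → ∃ n₀, ∀ n, n₀ ≤ n → ∀ k, partialNorm p ((u n).seq - z) k ≤ ε := by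
    intro ε hε
    obtain ⟨n₀, hn₀⟩ := Metric.cauchySeq_iff.1 hu ε hε
    refine ⟨n₀, fun n hn k => ?_⟩
    have hlim : Tendsto (fun m => ε + ∑ i ∈ Finset.range (k + 1), |(u m).seq i - z i|) atTop
        (𝓝 (ε + ∑ i ∈ Finset.range (k + 1), |z i - z i|)) :=
      tendsto_const_nhds.add (tendsto_finsetSum _ fun i _ => ((hz i).sub_const (z i)).abs)
    simp only [sub_self, abs_zero, Finset.sum_const_zero, add_zero] at hlim
    refine ge_of_tendsto hlim ?_
    filter_upwards [eventually_ge_atTop n₀] with m hm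
    have e : (u n).seq - z = (u n - u m).seq + ((u m).seq - z) := by
      rw [seq_sub]
      abel
    rw [e]
    refine (partialNorm_add_le p _ _ k).trans (add_le_add ?_ (partialNorm_le_sum _ k))
    refine (partialNorm_le_norm _ k).trans ?_
    rw [← dist_eq_norm]
    exact (hn₀ n hn m hm).le
  obtain ⟨n₁, hn₁⟩ := key 1 one_pos
  -- The limit belongs to the space because it differs from `u n₁` by an element of it.
  let w : VarLp p := u n₁ - ofBound _ 1 (hn₁ n₁ le_rfl)
  have hw : w.seq = z := by
    simp only [w, seq_sub, seq_ofBound]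
    abel
  refine ⟨w, Metric.tendsto_atTop.2 fun ε hε => ?_⟩
  obtain ⟨n₀, hn₀⟩ := key (ε / 2) (half_pos hε)
  refine ⟨n₀, fun n hn => ?_⟩
  rw [dist_eq_norm]
  refine lt_of_le_of_lt (ciSup_le fun k => ?_) (half_lt_self hε)
  rw [seq_sub, hw]
  exact hn₀ n hn k

/-! ### Disjoint estimates and superreflexivity under an equivalent norm. -/

section Estimates

variable {P Q K : ℝ}

theorem apply_eq_zero_or_of_disjoint {x y : VarLp p} (h : |x| ⊓ |y| = 0) (n : ℕ) :
    x.seq n = 0 ∨ y.seq n = 0 := by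
  have h1 : min |x.seq n| |y.seq n| = 0 := congrFun (congrArg seq h) n
  rcases min_choice |x.seq n| |y.seq n| with h2 | h2 <;> rw [h2] at h1
  · exact Or.inl (abs_eq_zero.1 h1)
  · exact Or.inr (abs_eq_zero.1 h1)

/-- The estimate has constant 1 for `p'`; passing to `p'` and back costs a factor `K` each time. -/
theorem hasUpperEstimate_of_equiv (hP : 0 < P)
    (hp : ∀ n, ENNReal.ofReal P ≤ p' n ∧ (p' n : ℝ≥0∞) ≤ ENNReal.ofReal Q) (hK : 0 ≤ K)
    (h : ∀ x k, partialNorm p x k ≤ K * partialNorm p' x k)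
    (h' : ∀ x k, partialNorm p' x k ≤ K * partialNorm p x k) :
    HasUpperEstimate (VarLp p) P (K * K) := by
  intro n x hx
  refine ciSup_le fun k => ?_
  rw [seq_sum, mul_assoc]
  have h1 := partialNorm_sum_rpow_le hP hp
    (fun i j hij => apply_eq_zero_or_of_disjoint (hx i j hij)) Finset.univ k
  refine (h _ k).trans (mul_le_mul_of_nonneg_left ?_ hK)
  rw [← Real.rpow_le_rpow_iff (partialNorm_nonneg p' _ k)
    (mul_nonneg hK (Real.rpow_nonneg (Finset.sum_nonneg fun i _ => by positivity) _)) hP,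
    Real.mul_rpow hK (Real.rpow_nonneg (Finset.sum_nonneg fun i _ => by positivity) _),
    ← Real.rpow_mul (Finset.sum_nonneg fun i _ => by positivity), one_div_mul_cancel hP.ne',
    Real.rpow_one, Finset.mul_sum]
  refine h1.trans (Finset.sum_le_sum fun i _ => ?_)
  rw [← Real.mul_rpow hK (norm_nonneg _)]
  exact Real.rpow_le_rpow (partialNorm_nonneg p' _ k)
    ((h' _ k).trans (mul_le_mul_of_nonneg_left (partialNorm_le_norm _ k) hK)) hP.le

theorem hasLowerEstimate_of_equiv (hP : 0 < P)
    (hp : ∀ n, ENNReal.ofReal P ≤ p' n ∧ (p' n : ℝ≥0∞) ≤ ENNReal.ofReal Q) (hK : 0 ≤ K)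
    (h : ∀ x k, partialNorm p x k ≤ K * partialNorm p' x k)
    (h' : ∀ x k, partialNorm p' x k ≤ K * partialNorm p x k) :
    HasLowerEstimate (VarLp p) Q (K * K) := by
  intro n x hx
  have hQ := exponent_pos_of_bounds hp
  -- Several norms stand on the smaller side, so a limit in `k` replaces the supremum bound of the
  -- upper estimate.
  have hlim : Tendsto (fun k => (∑ i, partialNorm p (x i).seq k ^ Q) ^ (1 / Q)) atTop
      (𝓝 ((∑ i, ‖x i‖ ^ Q) ^ (1 / Q))) :=
    (tendsto_finsetSum _ fun i _ => (tendsto_partialNorm (x i)).rpow_const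
      (Or.inr hQ.le)).rpow_const (Or.inr (by positivity))
  refine le_of_tendsto' hlim fun k => ?_
  have h0 : ∀ i, 0 ≤ partialNorm p (x i).seq k := fun i => partialNorm_nonneg p _ k
  have h1 := sum_rpow_le_partialNorm_sum hP hp
    (fun i j hij => apply_eq_zero_or_of_disjoint (hx i j hij)) Finset.univ k
  have h2 : partialNorm p' (∑ i, (x i).seq) k ≤ K * ‖∑ i, x i‖ := by
    rw [← seq_sum]
    exact (h' _ k).trans (mul_le_mul_of_nonneg_left (partialNorm_le_norm _ k) hK)
  have h3 := partialNorm_nonneg p' (∑ i, (x i).seq) k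
  rw [← Real.rpow_le_rpow_iff (Real.rpow_nonneg (Finset.sum_nonneg fun i _ =>
    Real.rpow_nonneg (h0 i) _) _) (by positivity) hQ,
    ← Real.rpow_mul (Finset.sum_nonneg fun i _ => Real.rpow_nonneg (h0 i) _),
    one_div_mul_cancel hQ.ne', Real.rpow_one, mul_assoc, Real.mul_rpow hK (by positivity)]
  calc ∑ i, partialNorm p (x i).seq k ^ Q ≤ ∑ i, K ^ Q * partialNorm p' (x i).seq k ^ Q :=
        Finset.sum_le_sum fun i _ => by
          rw [← Real.mul_rpow hK (partialNorm_nonneg p' _ k)]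
          exact Real.rpow_le_rpow (h0 i) (h _ k) hQ.le
    _ = K ^ Q * ∑ i, partialNorm p' (x i).seq k ^ Q := by rw [Finset.mul_sum]
    _ ≤ K ^ Q * (K * ‖∑ i, x i‖) ^ Q := by
        gcongr
        exact h1.trans (Real.rpow_le_rpow h3 h2 hQ.le)

theorem isSuperreflexiveSpace_of_equiv (hP : 1 < P) (hP2 : P ≤ 2) (hQ : 2 ≤ Q)
    (hp : ∀ n, ENNReal.ofReal P ≤ p' n ∧ (p' n : ℝ≥0∞) ≤ ENNReal.ofReal Q) (hK : 0 < K)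
    (h : ∀ x k, partialNorm p x k ≤ K * partialNorm p' x k)
    (h' : ∀ x k, partialNorm p' x k ≤ K * partialNorm p x k) :
    IsSuperreflexiveSpace (VarLp p) := by
  intro Y _ _ _ hY
  have hup : ∀ (x : VarLp p) k, partialNorm p' x.seq k ≤ K * ‖x‖ := fun x k =>
    (h' _ k).trans (mul_le_mul_of_nonneg_left (partialNorm_le_norm _ k) hK.le)
  -- The norm of `ℓ^{p'(·)}`, used as the equivalent function that satisfies the two-point
  -- inequality.
  let M : VarLp p → ℝ := fun x => ⨆ k, partialNorm p' x.seq k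
  have hM : ∀ x : VarLp p, Tendsto (partialNorm p' x.seq) atTop (𝓝 (M x)) := fun x =>
    tendsto_atTop_ciSup (partialNorm_monotone p' x.seq)
      ⟨K * ‖x‖, by rintro _ ⟨k, rfl⟩; exact hup x k⟩
  have hP0 : 0 < P := by linarith
  have hQ0 : 0 < Q := by linarith
  refine isReflexiveSpace_of_finitelyRepresentable M (a := K⁻¹) (b := K)
    (c := P * (P - 1) / 2) (P := P) (Q := Q) (by positivity) hK.le (by nlinarith) hP0 hQ0
    (fun x => ?_) (fun x => ciSup_le (hup x)) (fun x y => ?_) hY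
  · rw [inv_mul_le_iff₀ hK]
    exact le_of_tendsto_of_tendsto' (tendsto_partialNorm x) ((hM x).const_mul K) (h x.seq)
  · refine le_of_tendsto_of_tendsto'
      (((hM _).rpow_const (Or.inr hQ0.le)).add (((hM _).rpow_const (Or.inr hQ0.le)).const_mul _))
      (((((hM x).rpow_const (Or.inr hP0.le)).add
        ((hM y).rpow_const (Or.inr hP0.le))).div_const 2).rpow_const (Or.inr (by positivity)))
      (partialNorm_two_point_inequality hP hP2 hQ hp x.seq y.seq)

end Estimates

/-! ### Extreme exponents and `ℓ¹`-sequences. -/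

section SparseSubsequences

/-- A bounded sequence of weights, carried by the range of `φ`. -/
theorem exists_sparse_weights {φ : ℕ → ℕ} (hφ : StrictMono φ) :
    ∃ d : ℕ → ℝ, (∀ n, 0 ≤ d n) ∧ (∀ k, d (φ k) = (1 / 2) ^ (k + 1)) ∧
      ∀ k, ∑ j ∈ Finset.range k, d j ≤ 1 := by
  let d : ℕ → ℝ := Function.extend φ (fun k => (1 / 2 : ℝ) ^ (k + 1)) 0
  have hd : ∀ n, 0 ≤ d n := fun n => by
    by_cases h : ∃ k, φ k = n
    · obtain ⟨k, rfl⟩ := h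
      simp only [d, hφ.injective.extend_apply]
      positivity
    · simp [d, Function.extend_apply' _ _ _ h]
  have hsum : HasSum d 1 := by
    refine (hasSum_extend_zero hφ.injective).2 ?_
    have := hasSum_geometric_two.mul_right (1 / 2 : ℝ)
    simpa [pow_succ] using this
  exact ⟨d, hd, fun k => hφ.injective.extend_apply _ _ k,
    fun k => sum_le_hasSum _ (fun i _ => hd i) hsum⟩

theorem not_isAsplundSpace_of_one {φ : ℕ → ℕ} (hφ : StrictMono φ)
    (h : ∀ k, (p (φ k) : ℝ≥0∞) ≠ ∞ ∧ 1 - 1 / (p (φ k) : ℝ≥0∞).toReal ≤ (1 / 2) ^ (k + 1)) :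
    ¬ IsAsplundSpace (VarLp p) := by
  classical
  obtain ⟨d, hd, hdφ, hd1⟩ := exists_sparse_weights hφ
  have hinj : Function.Injective fun k => φ k + 1 :=
    fun i j hij => hφ.injective (by simpa using hij)
  -- The exponent `p (φ k)` adjoins coordinate `φ k + 1`, hence the shift.
  let y : ℕ → VarLp p := fun k => ofBound (Pi.single (φ k + 1) 1) 1 fun j =>
    (partialNorm_le_sum _ j).trans (by
      simp only [Pi.single_apply, apply_ite abs, abs_one, abs_zero, Finset.sum_ite_eq']
      split_ifs <;> norm_num)
  refine not_isAsplundSpace_of_l1_sequence y (K := 2) (M := 1) (fun k => norm_ofBound_le _ _ _)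
    fun a => ?_
  set v := ∑ k ∈ a.support, a k • y k with hv
  have hvn : ∀ n, v.seq n = ∑ k ∈ a.support, if n = φ k + 1 then a k else 0 := fun n => by
    rw [hv, seq_sum, Finset.sum_apply]
    refine Finset.sum_congr rfl fun k _ => ?_
    simp [seq_smul, y, seq_ofBound, Pi.single_apply]
  have hvφ : ∀ k, v.seq (φ k + 1) = a k := fun k => by
    rw [hvn]
    simp [hφ.injective.eq_iff, eq_comm]
  have hv0 : ∀ j, v.seq (j + 1) = 0 ∨
      ((p j : ℝ≥0∞) ≠ ∞ ∧ 1 - 1 / (p j : ℝ≥0∞).toReal ≤ d j) := fun j => by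
    by_cases hj : ∃ k, φ k = j
    · obtain ⟨k, rfl⟩ := hj
      exact Or.inr (hdφ k ▸ h k)
    · left
      rw [hvn]
      refine Finset.sum_eq_zero fun k _ => if_neg fun e => hj ⟨k, ?_⟩
      omega
  let s := a.support.image fun k => φ k + 1
  calc ∑ k ∈ a.support, |a k| = ∑ i ∈ s, |v.seq i| := by
        rw [Finset.sum_image fun i _ j _ hij => hinj hij]
        simp only [hvφ]
    _ ≤ ∑ i ∈ Finset.range (s.sup id + 1), |v.seq i| :=
        Finset.sum_le_sum_of_subset_of_nonneg
          (fun i hi => Finset.mem_range_succ_iff.2 (Finset.le_sup (f := id) hi))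
          fun _ _ _ => abs_nonneg _
    _ ≤ 2 ^ (∑ j ∈ Finset.range (s.sup id), d j) * partialNorm p v.seq (s.sup id) :=
        sum_abs_le_two_rpow_mul_partialNorm hd hv0 _
    _ ≤ 2 * ‖v‖ := by
        refine mul_le_mul ?_ (partialNorm_le_norm _ _) (partialNorm_nonneg p _ _) zero_le_two
        simpa using Real.rpow_le_rpow_of_exponent_le one_le_two (hd1 (s.sup id))

/-- Sign sequences on the chosen coordinates have norm at most 2. Labelling these coordinates by all
finite subsets of `ℕ` yields Rademacher-like vectors: every finite sign pattern occurs at some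
coordinate. -/
theorem not_isAsplundSpace_of_top {φ : ℕ → ℕ} (hφ : StrictMono φ)
    (h : ∀ k, 1 / (p (φ k) : ℝ≥0∞).toReal ≤ (1 / 2) ^ (k + 1)) :
    ¬ IsAsplundSpace (VarLp p) := by
  classical
  obtain ⟨d, hd, hdφ, hd1⟩ := exists_sparse_weights hφ
  have hinj : Function.Injective fun k => φ k + 1 :=
    fun i j hij => hφ.injective (by simpa using hij)
  let E : ℕ ≃ Finset ℕ := (Denumerable.eqv (Finset ℕ)).symm
  let ε : ℕ → ℕ → ℝ := fun k j => if k ∈ E j then -1 else 1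
  let z : ℕ → ℕ → ℝ := fun k => Function.extend (fun j => φ j + 1) (ε k) 0
  have hzφ : ∀ k j, z k (φ j + 1) = ε k j := fun k j => hinj.extend_apply _ _ j
  have hz0 : ∀ k n, (¬ ∃ j, φ j + 1 = n) → z k n = 0 := fun k n hn =>
    Function.extend_apply' _ _ _ hn
  have hz1 : ∀ k n, |z k n| ≤ 1 := fun k n => by
    by_cases hn : ∃ j, φ j + 1 = n
    · obtain ⟨j, rfl⟩ := hn
      rw [hzφ]
      simp only [ε]
      split_ifs <;> simp
    · simp [hz0 k n hn]
  have hzb : ∀ k j, partialNorm p (z k) j ≤ 2 := fun k j => by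
    refine (partialNorm_le_two_rpow hd (hz1 k) (fun j => ?_) j).trans
      (by simpa using Real.rpow_le_rpow_of_exponent_le one_le_two (hd1 j))
    by_cases hj : ∃ i, φ i = j
    · obtain ⟨i, rfl⟩ := hj
      exact Or.inr (hdφ i ▸ h i)
    · exact Or.inl (hz0 k _ fun ⟨i, hi⟩ => hj ⟨i, by omega⟩)
  refine not_isAsplundSpace_of_l1_sequence (fun k => ofBound (z k) 2 (hzb k)) (K := 1) (M := 2)
    (fun k => norm_ofBound_le _ _ _) fun a => ?_
  rw [one_mul]
  -- At the coordinate labelled by the set of negative coefficients, all signs match and the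
  -- combination equals `∑ |a k|`.
  refine le_trans (le_of_eq ?_) (abs_seq_le_norm _
    (φ (E.symm (a.support.filter fun k => a k < 0)) + 1))
  rw [seq_sum, Finset.sum_apply, ← abs_of_nonneg (Finset.sum_nonneg fun k _ => abs_nonneg (a k))]
  congr 1
  refine Finset.sum_congr rfl fun k hk => ?_
  simp only [seq_smul, seq_ofBound, Pi.smul_apply, smul_eq_mul, hzφ, ε, Equiv.apply_symm_apply,
    Finset.mem_filter, hk, true_and]
  split_ifs with hneg
  · rw [abs_of_neg hneg, mul_neg_one]
  · rw [abs_of_nonneg (not_lt.1 hneg), mul_one]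

theorem one_lt_liminf_of_isAsplundSpace (hA : IsAsplundSpace (VarLp p)) :
    1 < liminf (fun n => (p n : ℝ≥0∞)) atTop := by
  by_contra! hle
  have hfreq : ∀ k : ℕ, ∃ᶠ n in atTop, (p n : ℝ≥0∞) ≠ ∞ ∧
      1 - 1 / (p n : ℝ≥0∞).toReal ≤ (1 / 2) ^ (k + 1) := fun k => by
    have hpos : (0 : ℝ) < (1 / 2) ^ (k + 1) := by positivity
    have h1 : liminf (fun n => (p n : ℝ≥0∞)) atTop < ENNReal.ofReal (1 + (1 / 2) ^ (k + 1)) :=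
      hle.trans_lt (by rw [← ENNReal.ofReal_one]; exact (ENNReal.ofReal_lt_ofReal_iff
        (by linarith)).2 (by linarith))
    refine (frequently_lt_of_liminf_lt (by isBoundedDefault) h1).mono fun n hn => ?_
    have hne : (p n : ℝ≥0∞) ≠ ∞ := (hn.trans ENNReal.ofReal_lt_top).ne
    refine ⟨hne, ?_⟩
    have h2 := toReal_one_le (p n).2.1 hne
    have h3 := (ENNReal.lt_ofReal_iff_toReal_lt hne).1 hn
    -- The tangent line of `1 / r` at `r = 1`, which gives `1 - 1 / r ≤ r - 1`.
    have h4 : 1 - ((p n : ℝ≥0∞).toReal - 1) ≤ 1 / (p n : ℝ≥0∞).toReal := by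
      rw [le_div_iff₀ (by linarith)]
      nlinarith [sq_nonneg ((p n : ℝ≥0∞).toReal - 1)]
    linarith
  obtain ⟨φ, hφ, h⟩ := extraction_forall_of_frequently hfreq
  exact not_isAsplundSpace_of_one hφ h hA

theorem limsup_lt_top_of_isAsplundSpace (hA : IsAsplundSpace (VarLp p)) :
    limsup (fun n => (p n : ℝ≥0∞)) atTop < ∞ := by
  by_contra! hle
  have hfreq : ∀ k : ℕ, ∃ᶠ n in atTop, 1 / (p n : ℝ≥0∞).toReal ≤ (1 / 2) ^ (k + 1) := fun k => by
    have h1 : ENNReal.ofReal (2 ^ (k + 1)) < limsup (fun n => (p n : ℝ≥0∞)) atTop :=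
      ENNReal.ofReal_lt_top.trans_le hle
    refine (frequently_lt_of_lt_limsup (by isBoundedDefault) h1).mono fun n hn => ?_
    by_cases hne : (p n : ℝ≥0∞) = ∞
    · simp [hne]
    · have h3 := (ENNReal.ofReal_lt_iff_lt_toReal (by positivity) hne).1 hn
      rw [one_div_pow]
      exact one_div_le_one_div_of_le (by positivity) h3.le
  obtain ⟨φ, hφ, h⟩ := extraction_forall_of_frequently hfreq
  exact not_isAsplundSpace_of_top hφ h hA

end SparseSubsequences

/-! ### Adjusting the exponents and conclusion. -/

/-- If the exponents are eventually between `P` and `Q`, then changing finitely many of them gives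
an equivalent norm for which all exponents are between `P` and `Q`. -/
theorem exists_equiv_exponents {P Q : ℝ} (hP : 1 ≤ P) (hPQ : P ≤ Q)
    (h : ∀ᶠ n in atTop, ENNReal.ofReal P ≤ p n ∧ (p n : ℝ≥0∞) ≤ ENNReal.ofReal Q) :
    ∃ (p' : ℕ → Set.Icc (1 : ℝ≥0∞) ∞) (K : ℝ),
      (∀ n, ENNReal.ofReal P ≤ p' n ∧ (p' n : ℝ≥0∞) ≤ ENNReal.ofReal Q) ∧ 0 < K ∧
      (∀ x k, partialNorm p x k ≤ K * partialNorm p' x k) ∧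
      ∀ x k, partialNorm p' x k ≤ K * partialNorm p x k := by
  obtain ⟨m, hm⟩ := eventually_atTop.1 h
  let p' : ℕ → Set.Icc (1 : ℝ≥0∞) ∞ := fun n =>
    if m ≤ n then p n else ⟨ENNReal.ofReal P, by simpa using hP, le_top⟩
  have hp' : ∀ n, m ≤ n → p n = p' n := fun n hn => (if_pos hn).symm
  refine ⟨p', 2 ^ m, fun n => ?_, by positivity, partialNorm_le_two_pow_mul hp',
    partialNorm_le_two_pow_mul fun n hn => (hp' n hn).symm⟩
  rcases le_or_gt m n with hn | hn
  · rw [← hp' n hn]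
    exact hm n hn
  · simp only [p', if_neg hn.not_ge]
    exact ⟨le_rfl, ENNReal.ofReal_le_ofReal hPQ⟩

theorem exists_bounds_of_liminf_of_limsup
    (h : 1 < liminf (fun n => (p n : ℝ≥0∞)) atTop ∧ limsup (fun n => (p n : ℝ≥0∞)) atTop < ∞) :
    ∃ P Q : ℝ, 1 < P ∧ P ≤ Q ∧ ENNReal.ofReal P ≤ liminf (fun n => (p n : ℝ≥0∞)) atTop ∧
      limsup (fun n => (p n : ℝ≥0∞)) atTop ≤ ENNReal.ofReal Q ∧
      ∀ᶠ n in atTop, ENNReal.ofReal P ≤ p n ∧ (p n : ℝ≥0∞) ≤ ENNReal.ofReal Q := by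
  -- Strict inequalities with the liminf and limsup make the bounds hold eventually.
  obtain ⟨P, hP1, hP⟩ := ENNReal.lt_iff_exists_nnreal_btwn.1 h.1
  obtain ⟨Q, hQ, -⟩ := ENNReal.lt_iff_exists_nnreal_btwn.1 h.2
  have hPQ : (P : ℝ≥0∞) ≤ Q := (hP.le.trans (liminf_le_limsup)).trans hQ.le
  refine ⟨P, Q, by exact_mod_cast hP1, by exact_mod_cast hPQ, ?_, ?_, ?_⟩
  · simpa using hP.le
  · simpa using hQ.le
  · filter_upwards [eventually_lt_of_lt_liminf hP, eventually_lt_of_limsup_lt hQ] with n h1 h2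
    simpa using And.intro h1.le h2.le

end VarLp

theorem mainTheorem4 (p : ℕ → Set.Icc (1 : ℝ≥0∞) ∞) :
    List.TFAE
      [IsReflexiveSpace (VarLp p),
       IsSuperreflexiveSpace (VarLp p),
       1 < liminf (fun n => (p n : ℝ≥0∞)) atTop ∧ limsup (fun n => (p n : ℝ≥0∞)) atTop < ∞,
       IsAsplundSpace (VarLp p)] ∧
    (1 < liminf (fun n => (p n : ℝ≥0∞)) atTop ∧ limsup (fun n => (p n : ℝ≥0∞)) atTop < ∞ →
      ∃ p₀ q₀ C : ℝ, 1 < p₀ ∧ p₀ ≤ q₀ ∧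
        ENNReal.ofReal p₀ ≤ liminf (fun n => (p n : ℝ≥0∞)) atTop ∧
        limsup (fun n => (p n : ℝ≥0∞)) atTop ≤ ENNReal.ofReal q₀ ∧
        HasUpperEstimate (VarLp p) p₀ C ∧ HasLowerEstimate (VarLp p) q₀ C) ∧
    (∀ p₀ q₀ : ℝ, 1 < p₀ →
      (∀ n, ENNReal.ofReal p₀ ≤ p n ∧ (p n : ℝ≥0∞) ≤ ENNReal.ofReal q₀) →
      HasUpperEstimate (VarLp p) p₀ 1 ∧ HasLowerEstimate (VarLp p) q₀ 1) := by
  refine ⟨?_, fun h => ?_, fun p₀ q₀ hp₀ h => ?_⟩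
  · tfae_have 3 → 2 := fun h => by
      obtain ⟨P, Q, hP, hPQ, -, -, hev⟩ := VarLp.exists_bounds_of_liminf_of_limsup h
      -- The interval is widened to contain 2, as the two-point inequality requires.
      obtain ⟨p', K, hp', hK, h1, h2⟩ := VarLp.exists_equiv_exponents (P := min P 2)
        (Q := max Q 2) (le_min hP.le one_le_two)
        ((min_le_left _ _).trans (hPQ.trans (le_max_left _ _)))
        (hev.mono fun n hn => ⟨(ENNReal.ofReal_le_ofReal (min_le_left _ _)).trans hn.1,
          hn.2.trans (ENNReal.ofReal_le_ofReal (le_max_left _ _))⟩)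
      exact VarLp.isSuperreflexiveSpace_of_equiv (lt_min hP one_lt_two) (min_le_right _ _)
        (le_max_right _ _) hp' hK h1 h2
    tfae_have 2 → 1 := fun h => h _ FinitelyRepresentable.refl
    tfae_have 1 → 4 := fun h => h.isAsplundSpace VarLp.coord VarLp.eq_zero_of_coord_eq_zero
    tfae_have 4 → 3 := fun h =>
      ⟨VarLp.one_lt_liminf_of_isAsplundSpace h, VarLp.limsup_lt_top_of_isAsplundSpace h⟩
    tfae_finish
  · obtain ⟨P, Q, hP, hPQ, hP', hQ', hev⟩ := VarLp.exists_bounds_of_liminf_of_limsup h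
    obtain ⟨p', K, hp', hK, h1, h2⟩ := VarLp.exists_equiv_exponents hP.le hPQ hev
    exact ⟨P, Q, K * K, hP, hPQ, hP', hQ',
      VarLp.hasUpperEstimate_of_equiv (by linarith) hp' hK.le h1 h2,
      VarLp.hasLowerEstimate_of_equiv (by linarith) hp' hK.le h1 h2⟩
  -- The constant is `K * K` with `K = 1`, the exponents being left unchanged.
  · rw [← one_mul (1 : ℝ)]
    have h1 : ∀ x k, partialNorm p x k ≤ 1 * partialNorm p x k := fun x k => (one_mul _).ge
    exact ⟨VarLp.hasUpperEstimate_of_equiv (by linarith) h zero_le_one h1 h1,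
      VarLp.hasLowerEstimate_of_equiv (by linarith) h zero_le_one h1 h1⟩
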